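/- **Setting.** A $d$-dimensional continuous vector addition system (CVAS) is a finite set $\Sigma\subset\mathbb Z^d$ of transitions; a configuration is a vector in $\mathbb Q_{+}^d$, where $\mathbb Q_+$ is the set of non-negative rationals. For $t\in\Sigma$ and a rational $\alpha\in(0,1]$ there is a step $\mathbf x\xrightarrow{\alpha t}\mathbf y$ between configurations iff $\mathbf y=\mathbf x+\alpha t$. For configurations $\mathbf x,\mathbf y$, let $L_\Sigma^{\mathbf x,\mathbf y}$ be the set of words $t_1\cdots t_n\in\Sigma^*$ for which there are rationals $\alpha_1,\dots,\alpha_n\in(0,1]$ and configurations $\mathbf x=\mathbf x_0\xrightarrow{\alpha_1t_1}\mathbf x_1\cdots\xrightarrow{\alpha_nt_n}\mathbf x_n=\mathbf y$. A *bubble* over $\Sigma$ is either a *star* $X_A$ with $A\subseteq\Sigma$, whose language is $A^*$, or a *gathering* $X_{a_1\dots a_n}^{b_1\dots b_n}$, where $a_1,\dots,a_n\in\Sigma$ are pairwise distinct and $b_1,\dots,b_n$ is a permutation of them. The language of the gathering is the set of words $a_1w_1\cdots a_nw_n\,b_1v_1\cdots b_nv_n$ with $w_i\in\{a_1,\dots,a_i\}^*$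 and $v_i\in(\{a_1,\dots,a_n\}\setminus\{b_1,\dots,b_i\})^*$ for all $i$. A *path-scheme* is an expression $\rho=u_0X_1u_1\cdots X_nu_n$ with words $u_i\in\Sigma^*$ and bubbles $X_i$; its language $L(\rho)$ is the set of words $u_0w_1u_1\cdots w_nu_n$ with $w_i\in L(X_i)$ for all $i$. Its *weight* $W(\rho)\in\mathbb N^{|\Sigma|}$ has as its $i$-th component ($1\le i\le|\Sigma|$) the number of bubbles of $\rho$ with exactly $i$ distinct letters. Weights are compared lexicographically with the last component most significant: $W(\sigma)<_{\mathrm{lex}}W(\rho)$ iff there is an $i$ with $W(\sigma)_i<W(\rho)_i$ and $W(\sigma)_j=W(\rho)_j$ for all $j>i$. A path-scheme $\rho$ is *perfect* (for $\Sigma,\mathbf x,\mathbf y$) if all of its bubbles are gatherings and $L(\rho)\cap L_\Sigma^{\mathbf x,\mathbf y}\neq\emptyset$. **Theorem (Perfect Path-Scheme Decomposition).** There is an algorithm which, given $d$, a $d$-dimensional CVAS $\Sigma$, configurations $\mathbf x,\mathbf y\in\mathbb Q_+^d$, and a path-scheme $\rho$ over $\Sigma$ that is perfect for $\Sigma,\mathbf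 x,\mathbf y$, halts and outputs a path-scheme $\sigma$ and a finite (possibly empty) list of path-schemes $\rho_1,\dots,\rho_m$ over $\Sigma$ such that $$L(\rho)=L(\sigma)\cup\bigcup_{i=1}^m L(\rho_i),\qquad L(\sigma)\subseteq L_\Sigma^{\mathbf x,\mathbf y},\qquad W(\rho_i)<_{\mathrm{lex}}W(\rho)\ \text{ for all } i.$$ -/

import Mathlib

open scoped NNRat

namespace CVAS

/-! ### Continuous vector addition systems

A `d`-dimensional CVAS is a finite set `S : Finset (Fin d → ℤ)` of transitions. Its letters are
the elements of `S`, and its words are the lists over `S`. -/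

/-- A configuration: a vector of `d` non-negative rational numbers. -/
abbrev Config (d : ℕ) : Type := Fin d → ℚ≥0

/-- `Step x α t y`: the step from `x` to `y = x + α t` with firing fraction `α ∈ (0, 1]`. -/
def Step {d : ℕ} (x : Config d) (α : ℚ) (t : Fin d → ℤ) (y : Config d) : Prop :=
  0 < α ∧ α ≤ 1 ∧ ∀ i, (y i : ℚ) = (x i : ℚ) + α * (t i : ℚ)

/-- `Run x r y`: the firing sequence `r = (α₁, t₁), …, (αₙ, tₙ)` leads from `x` to `y`. -/
def Run {d : ℕ} {S : Finset (Fin d → ℤ)} : Config d → List (ℚ × S) → Config d → Prop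
  | x, [], y => x = y
  | x, (α, t) :: r, y => ∃ z : Config d, Step x α (t : Fin d → ℤ) z ∧ Run z r y

/-- The transition language of the CVAS `S` between `x` and `y`. -/
def transitionLanguage {d : ℕ} (S : Finset (Fin d → ℤ)) (x y : Config d) : Language S :=
  {w | ∃ α : List ℚ, α.length = w.length ∧ Run x (α.zip w) y}

/-! ### Path-schemes over an alphabet `A` -/

/-- A bubble is a star `X_B` for a finite set `B` of letters, or a gathering with lower sequence
`as = a₁ … aₙ` and upper sequence `bs = b₁ … bₙ`, where the `aᵢ` are pairwise distinct and the `bᵢ`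
are the same letters in a possibly different order. -/
inductive Bubble (A : Type) : Type
  | star (B : Finset A) : Bubble A
  | gathering (as bs : List A) (nodup : as.Nodup) (perm : as.Perm bs) : Bubble A

/-- The words that match the gathering with lower sequence `as` and upper sequence `bs`, that is,
`a₁ w₁ … aₙ wₙ b₁ v₁ … bₙ vₙ` where `wᵢ` is a word over `{a₁, …, aᵢ}` and
`vᵢ` is a word over `{a₁, …, aₙ} \ {b₁, …, bᵢ}`. -/
def gatheringLanguage {A : Type} (as bs : List A) : Language A :=
  {u | ∃ (w : Fin as.length → List A) (v : Fin bs.length → List A),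
    (∀ i, ∀ a ∈ w i, a ∈ as.take (i.val + 1)) ∧
    (∀ i, ∀ a ∈ v i, a ∈ as ∧ a ∉ bs.take (i.val + 1)) ∧
    u = (List.ofFn fun i => as.get i :: w i).flatten ++
        (List.ofFn fun i => bs.get i :: v i).flatten}

/-- The language of a bubble. -/
def Bubble.language {A : Type} : Bubble A → Language A
  | .star B => {w | ∀ a ∈ w, a ∈ B}
  | .gathering as bs _ _ => gatheringLanguage as bs

/-- The number of distinct letters of a bubble. -/
def Bubble.size {A : Type} : Bubble A → ℕ
  | .star B => B.card
  | .gathering as _ _ _ => as.length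

/-- The bubble is a gathering. -/
def Bubble.IsGathering {A : Type} : Bubble A → Prop
  | .star _ => False
  | .gathering _ _ _ _ => True

/-- The path-scheme `u₀ X₁ u₁ … Xₙ uₙ`, with `head = u₀` and `tail = [(X₁, u₁), …, (Xₙ, uₙ)]`. -/
structure PathScheme (A : Type) : Type where
  head : List A
  tail : List (Bubble A × List A)

/-- The words `u₀ w₁ u₁ … wₙ uₙ` with `wᵢ ∈ L(Xᵢ)` (products of languages are concatenations). -/
def PathScheme.language {A : Type} (ρ : PathScheme A) : Language A :=
  ({ρ.head} : Language A) *
    (ρ.tail.map fun p => p.1.language * ({p.2} : Language A)).prod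

/-- All bubbles are gatherings. -/
def PathScheme.IsPrePerfect {A : Type} (ρ : PathScheme A) : Prop :=
  ∀ p ∈ ρ.tail, p.1.IsGathering

/-- Pre-perfect, and the language meets the transition language. -/
def PathScheme.IsPerfect {d : ℕ} {S : Finset (Fin d → ℤ)} (x y : Config d)
    (ρ : PathScheme S) : Prop :=
  ρ.IsPrePerfect ∧ ∃ w, w ∈ ρ.language ∧ w ∈ transitionLanguage S x y

/-- The unit vector of a bubble with `k` distinct letters. The component with index `i` belongs to
the size `i + 1`, as the indices start at `0`; a bubble without letters has weight `0`. -/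
def Bubble.weight {A : Type} [Fintype A] (X : Bubble A) : Fin (Fintype.card A) → ℕ :=
  fun i => if X.size = i.val + 1 then 1 else 0

/-- The weight of a path-scheme: the sum of the weights of its bubbles. -/
def PathScheme.weight {A : Type} [Fintype A] (ρ : PathScheme A) : Fin (Fintype.card A) → ℕ :=
  (ρ.tail.map fun p => p.1.weight).sum

/-- The strict lexicographic order in which the last component is the most significant. -/
def LexLT {n : ℕ} (v w : Fin n → ℕ) : Prop :=
  ∃ i, v i < w i ∧ ∀ j, i < j → v j = w j

/-! ### Finite codes for the objects that an algorithm reads and writes -/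

/-- Codes of transitions: the list of the coordinates. -/
abbrev LetterCode : Type := List ℤ

/-- Codes of words. -/
abbrev WordCode : Type := List LetterCode

/-- Codes of bubbles: a list of the elements for a star, the two sequences for a gathering. -/
abbrev BubbleCode : Type := List LetterCode ⊕ (List LetterCode × List LetterCode)

/-- Codes of path-schemes. -/
abbrev SchemeCode : Type := WordCode × List (BubbleCode × WordCode)

/-- Codes of configurations: a list of pairs (numerator, denominator). -/
abbrev ConfigCode : Type := List (ℕ × ℕ)

/-- Codes of inputs: the dimension, the transitions, the two configurations, a path-scheme. -/
abbrev InputCode : Type := ℕ × List LetterCode × ConfigCode × ConfigCode × SchemeCode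

/-- The code of a transition. -/
def letterCode {d : ℕ} (t : Fin d → ℤ) : LetterCode := List.ofFn t

/-- The code of a word. -/
def wordCode {d : ℕ} {S : Finset (Fin d → ℤ)} (w : List S) : WordCode :=
  w.map fun t => letterCode (t : Fin d → ℤ)

/-- The code of a configuration, with reduced fractions. -/
def configCode {d : ℕ} (x : Config d) : ConfigCode :=
  List.ofFn fun i => ((x i).num, (x i).den)

/-- `c` codes the CVAS `S`: it lists the transitions in some order without repetition. -/
def IsSystemCode {d : ℕ} (S : Finset (Fin d → ℤ)) (c : List LetterCode) : Prop :=
  ∃ l : List (Fin d → ℤ), l.Nodup ∧ (∀ t, t ∈ l ↔ t ∈ S) ∧ c = l.map letterCode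

/-- `c` codes the bubble; the elements of a star are listed in some order without repetition. -/
def Bubble.IsCode {d : ℕ} {S : Finset (Fin d → ℤ)} : Bubble S → BubbleCode → Prop
  | .star B, c => ∃ l : List S, l.Nodup ∧ (∀ t, t ∈ l ↔ t ∈ B) ∧ c = Sum.inl (wordCode l)
  | .gathering as bs _ _, c => c = Sum.inr (wordCode as, wordCode bs)

/-- `c` codes the path-scheme. -/
def PathScheme.IsCode {d : ℕ} {S : Finset (Fin d → ℤ)} (ρ : PathScheme S) (c : SchemeCode) :
    Prop :=
  c.1 = wordCode ρ.head ∧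
    List.Forall₂ (fun p q => p.1.IsCode q.1 ∧ q.2 = wordCode p.2) ρ.tail c.2

/-- `c` codes the input consisting of the CVAS `S`, the configurations `x`, `y`, and `ρ`. -/
def IsInputCode {d : ℕ} (S : Finset (Fin d → ℤ)) (x y : Config d) (ρ : PathScheme S)
    (c : InputCode) : Prop :=
  c.1 = d ∧ IsSystemCode S c.2.1 ∧ c.2.2.1 = configCode x ∧ c.2.2.2.1 = configCode y ∧
    ρ.IsCode c.2.2.2.2

end CVAS

/-!
The decomposition rests on a description of a gathering `X` with lower sequence `a₁ … aₙ` and upper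
sequence `b₁ … bₙ` as a path-scheme with stars only:
`a₁ {a₁}* a₂ … {a₁, …, aₙ₋₁}* aₙ A* b₁ {b₂, …, bₙ}* … bₙ` with `A = {a₁, …, aₙ}`
(`gatheringLanguage_eq`). Its only star on all `n` letters is the middle one. For a word
`z = z₁ … z_M` over `A`, the greedy match of a word with `z` either succeeds or stops, so
`A* = A* z₁ A* … z_M A* ∪ ⋃_{k < M} (A \ {z₁})* z₁ … z_k (A \ {z_{k+1}})*`
(`star_subset_middles`). For `z = (a₁ … aₙ)ᴺ`, the path-scheme `σ` takes the first alternative in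
every gathering, and each `ρᵢ` takes one of the other alternatives in one gathering and leaves the
rest of `ρ` as it is. In `ρᵢ` a bubble of size `n` is thus replaced by bubbles of smaller size, so
that the weight decreases (`sizeCount_poorTails`). The equality of languages holds for every `N`
(`tail_decomposition`).

It remains to find an `N` for which all words of `σ` label runs. The search is for a run of the
single word that has `a₁ … aₙ (a₁ … aₙ)ᴺ b₁ … bₙ` in the place of each gathering, such that the
steps of `a₁ … aₙ (a₁ … aₙ)ᴺ` never shrink the support of the configuration and those of
`b₁ … bₙ` never enlarge it.

* Such a run suffices (`richTail_subset`). In it, a coordinate is positive whenever it has been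
  changed before and will be changed again within the gathering (`RobustRun.of_up_down`). Hence a
  letter may be inserted between two of its occurrences: it is fired with a tiny fraction, which an
  earlier occurrence gives up (`RobustRun.insert`). All words of `σ` arise by such insertions.
* Such a run exists for all large `N` if `ρ` is perfect (`exists_flagTail_run`). Given a run from
  `x` to `y` of a word of the gathering, every coordinate decreased by `aᵢ` is positive in `x` or
  increased by an earlier `aₖ`, so that `a₁ … aₙ` can be fired from `x` with tiny fractions and
  leads to a configuration `p` in which all changed coordinates are positive (`exists_up_run`).
  Symmetrically, there is such a configuration `q` from which `b₁ … bₙ` leads to `y`. Since the tiny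
  fractions use up only a part of the total fraction of each letter, `q - p` is a positive
  combination of the letters, and firing them cyclically in many rounds stays close to the segment
  from `p` to `q` (`exists_cycle_run`).

A run, scaled by a common denominator, is a finite object whose correctness is primitive recursive
(`primrecPred_check`), so the unbounded search for `N` together with such a run is a partial
recursive function (`partrec_decompose`), and it terminates on perfect path-schemes.
-/

namespace CVAS

/-! ### List-level path-schemes -/

/-- A bubble as bare data: a star given by a list of its letters, or a gathering given by its two
sequences. For `A = LetterCode` this is `BubbleCode`. -/
abbrev RawBubble (A : Type) : Type := List A ⊕ (List A × List A)

/-- The part `X₁ u₁ … Xₙ uₙ` of a path-scheme, as bare data. -/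
abbrev RawTail (A : Type) : Type := List (RawBubble A × List A)

/-- A gathering, given by its two sequences, and the word that follows it. -/
abbrev GatheringEntry (A : Type) : Type := (List A × List A) × List A

/-- The language of a bubble given as bare data. -/
def RawBubble.language {A : Type} : RawBubble A → Language A
  | .inl B => {w | ∀ a ∈ w, a ∈ B}
  | .inr g => gatheringLanguage g.1 g.2

/-- The words `w₁ u₁ … wₙ uₙ` with `wᵢ ∈ L(Xᵢ)`. -/
def tailLanguage {A : Type} (l : RawTail A) : Language A :=
  (l.map fun p => RawBubble.language p.1 * ({p.2} : Language A)).prod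

/-- The number of letters of a bubble given as bare data. -/
def RawBubble.size {A : Type} : RawBubble A → ℕ
  | .inl B => B.length
  | .inr g => g.1.length

/-- A gathering entry as an entry of a path-scheme. -/
def GatheringEntry.toRaw {A : Type} (g : GatheringEntry A) : RawBubble A × List A := (.inr g.1, g.2)

/-- One step in the construction of `lowerPart`: the state consists of the letters read so far
and the entries produced so far. -/
def lowerStep {A : Type} (s : List A × RawTail A) (a : A) : List A × RawTail A :=
  (s.1 ++ [a], s.2 ++ [(.inl s.1, [a])])

/-- `∅* a₁ {a₁}* a₂ … {a₁, …, aₙ₋₁}* aₙ`: the part of a gathering with lower sequence `a₁ … aₙ`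
that precedes the star on all letters. -/
def lowerPart {A : Type} (as : List A) : RawTail A := (as.foldl lowerStep ([], [])).2

/-- `b₁ {b₂, …, bₙ}* b₂ … {bₙ}* bₙ ∅*`: the part of a gathering with upper sequence `b₁ … bₙ`
that follows the star on all letters. -/
def upperPart {A : Type} : List A → RawTail A
  | [] => []
  | b :: bs => (.inl [], [b]) :: (.inl bs, []) :: upperPart bs

/-- The gathering entry with the star on all of its letters replaced by `m`. -/
def GatheringEntry.unfold {A : Type} (g : GatheringEntry A) (m : RawTail A) : RawTail A :=
  lowerPart g.1.1 ++ m ++ upperPart g.1.2 ++ [(.inl [], g.2)]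

/-- The word `(a₁ … aₙ)ᴺ`. -/
def cyclePow {A : Type} (N : ℕ) (as : List A) : List A := (List.replicate N as).flatten

/-- `A* z₁ A* z₂ … z_M A*`: the words over `A` that contain `z₁ … z_M` as a scattered subword. -/
def richMiddle {A : Type} (as z : List A) : RawTail A :=
  z.map (fun c => (.inl as, [c])) ++ [(.inl as, [])]

/-- The expressions `(A \ {z₁})* z₁ … z_k (A \ {z_{k+1}})*` with `k < M`: the words over `A` whose
greedy match with `z₁ … z_M` stops after `k` letters. -/
def poorMiddles {A : Type} [DecidableEq A] (as : List A) : List A → List (RawTail A)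
  | [] => []
  | c :: z => [(.inl (as.filter fun a => a ≠ c), [])] ::
      (poorMiddles as z).map fun m => (.inl (as.filter fun a => a ≠ c), [c]) :: m

/-- Every gathering is restricted to the words whose middle contains `(a₁ … aₙ)ᴺ`. -/
def richTail {A : Type} (N : ℕ) (l : List (GatheringEntry A)) : RawTail A :=
  l.flatMap fun g => g.unfold (richMiddle g.1.1 (cyclePow N g.1.1))

/-- One gathering is replaced by a path-scheme for those of its words that `richTail` misses. -/
def poorTails {A : Type} [DecidableEq A] (N : ℕ) : List (GatheringEntry A) → List (RawTail A)
  | [] => []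
  | g :: l => (poorMiddles g.1.1 (cyclePow N g.1.1)).map
        (fun m => g.unfold m ++ l.map GatheringEntry.toRaw) ++
      (poorTails N l).map (fun t => g.toRaw :: t)

/-! ### Languages -/

section Languages

variable {A : Type}

theorem mem_star_language {B w : List A} :
    w ∈ RawBubble.language (.inl B : RawBubble A) ↔ ∀ a ∈ w, a ∈ B := Iff.rfl

theorem singleton_nil_language : ({[]} : Language A) = 1 := rfl

@[simp] theorem star_nil_language : RawBubble.language (.inl [] : RawBubble A) = 1 := by
  ext w
  rw [mem_star_language, Language.mem_one, List.eq_nil_iff_forall_not_mem]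
  simp

@[simp] theorem tailLanguage_nil : tailLanguage ([] : RawTail A) = 1 := rfl

@[simp] theorem tailLanguage_cons (p : RawBubble A × List A) (l : RawTail A) :
    tailLanguage (p :: l) = RawBubble.language p.1 * {p.2} * tailLanguage l := by
  simp [tailLanguage]

@[simp] theorem tailLanguage_append (l l' : RawTail A) :
    tailLanguage (l ++ l') = tailLanguage l * tailLanguage l' := by
  simp [tailLanguage]

theorem mem_tailLanguage_cons_star {B u w : List A} {l : RawTail A} :
    w ∈ tailLanguage ((.inl B, u) :: l) ↔
      ∃ s t, (∀ a ∈ s, a ∈ B) ∧ t ∈ tailLanguage l ∧ w = s ++ u ++ t := by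
  rw [tailLanguage_cons, Language.mem_mul]
  constructor
  · rintro ⟨_, h, t, ht, rfl⟩
    obtain ⟨s, hs, _, rfl, rfl⟩ := Language.mem_mul.1 h
    exact ⟨s, t, hs, ht, rfl⟩
  · rintro ⟨s, t, hs, ht, rfl⟩
    exact ⟨s ++ u, Language.mem_mul.2 ⟨s, hs, u, rfl, rfl⟩, t, ht, rfl⟩

/-- The lower part of a gathering when the letters in `pre` have been read already. -/
def lowerFrom (pre : List A) : List A → RawTail A
  | [] => []
  | a :: as => (.inl pre, [a]) :: lowerFrom (pre ++ [a]) as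

theorem foldl_lowerStep (as pre : List A) (out : RawTail A) :
    as.foldl lowerStep (pre, out) = (pre ++ as, out ++ lowerFrom pre as) := by
  induction as generalizing pre out with
  | nil => simp [lowerFrom]
  | cons a as ih => simp [lowerStep, ih, lowerFrom]

theorem lowerPart_eq (as : List A) : lowerPart as = lowerFrom [] as := by
  simp [lowerPart, foldl_lowerStep]

/-- The words whose letters all satisfy `Q`. -/
def wordsOver (Q : A → Prop) : Language A := {w | ∀ x ∈ w, Q x}

/-- The words `a₁ w₁ … aₙ wₙ` such that the letters of `wᵢ` satisfy `Q (i - 1)`. -/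
def blockLanguage (Q : ℕ → A → Prop) : List A → Language A
  | [] => 1
  | a :: l => {[a]} * wordsOver (Q 0) * blockLanguage (fun i => Q (i + 1)) l

theorem mem_blockLanguage {l : List A} {Q : ℕ → A → Prop} {u : List A} :
    u ∈ blockLanguage Q l ↔ ∃ w : Fin l.length → List A, (∀ i, ∀ a ∈ w i, Q i.val a) ∧
      u = (List.ofFn fun i => l.get i :: w i).flatten := by
  induction l generalizing Q u with
  | nil => simp [blockLanguage, Language.mem_one]
  | cons a l ih =>
    rw [blockLanguage, mul_assoc, Language.mem_mul]
    constructor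
    · rintro ⟨_, rfl, t, ht, rfl⟩
      obtain ⟨s, hs, r, hr, rfl⟩ := Language.mem_mul.1 ht
      obtain ⟨w, hw, rfl⟩ := ih.1 hr
      refine ⟨Fin.cons s w, fun i => ?_, ?_⟩
      · refine Fin.cases ?_ (fun i => ?_) i
        · exact fun a ha => hs a ha
        · simpa using hw i
      · simp [List.ofFn_succ]
    · rintro ⟨w, hw, rfl⟩
      refine ⟨[a], rfl, _, Language.mem_mul.2 ⟨w 0, hw 0, _,
        ih.2 ⟨fun i => w i.succ, fun i => hw i.succ, rfl⟩, rfl⟩, ?_⟩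
      simp [List.ofFn_succ]

theorem blockLanguage_congr {l : List A} {Q R : ℕ → A → Prop}
    (h : ∀ i < l.length, ∀ a, Q i a ↔ R i a) : blockLanguage Q l = blockLanguage R l := by
  induction l generalizing Q R with
  | nil => rfl
  | cons a l ih =>
    rw [blockLanguage, blockLanguage, ih (fun i hi => h (i + 1) (by simpa using hi))]
    rw [show Q 0 = R 0 from funext fun x => propext (h 0 (by simp) x)]

theorem star_mul_blockLanguage (as pre : List A) :
    RawBubble.language (.inl pre : RawBubble A) *
        blockLanguage (fun i a => a ∈ pre ++ as.take (i + 1)) as =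
      tailLanguage (lowerFrom pre as) * RawBubble.language (.inl (pre ++ as) : RawBubble A) := by
  induction as generalizing pre with
  | nil => simp [blockLanguage, lowerFrom]
  | cons a as ih =>
    have := ih (pre ++ [a])
    simp only [List.append_assoc, List.singleton_append] at this
    rw [lowerFrom, tailLanguage_cons, mul_assoc, ← this, blockLanguage]
    simp only [mul_assoc, List.take_succ_cons]
    rfl

theorem blockLanguage_upper (bs : List A) :
    blockLanguage (fun i a => a ∈ bs.drop (i + 1)) bs = tailLanguage (upperPart bs) := by
  induction bs with
  | nil => rfl
  | cons b bs ih =>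
    rw [upperPart, tailLanguage_cons, tailLanguage_cons, ← ih, blockLanguage]
    simp [singleton_nil_language, mul_assoc]
    rfl

theorem gatheringLanguage_eq {as bs : List A} (hn : as.Nodup) (hp : as.Perm bs) :
    gatheringLanguage as bs = tailLanguage (lowerPart as) *
      RawBubble.language (.inl as : RawBubble A) * tailLanguage (upperPart bs) := by
  have h1 := star_mul_blockLanguage as []
  simp only [star_nil_language, one_mul, List.nil_append] at h1
  rw [lowerPart_eq, ← h1, ← blockLanguage_upper]
  have h2 : blockLanguage (fun i a => a ∈ as ∧ a ∉ bs.take (i + 1)) bs =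
      blockLanguage (fun i a => a ∈ bs.drop (i + 1)) bs := by
    refine blockLanguage_congr fun i _ a => ?_
    have hb : bs.Nodup := hp.nodup_iff.1 hn
    have hm : a ∈ bs ↔ a ∈ bs.take (i + 1) ∨ a ∈ bs.drop (i + 1) := by
      rw [← List.mem_append, List.take_append_drop]
    rw [← List.take_append_drop (i + 1) bs] at hb
    have := List.disjoint_of_nodup_append hb
    rw [hp.mem_iff, hm]
    constructor
    · tauto
    · exact fun h => ⟨Or.inr h, fun h' => this h' h⟩
  rw [← h2]
  ext u
  rw [Language.mem_mul]
  constructor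
  · rintro ⟨w, v, hw, hv, rfl⟩
    exact ⟨_, mem_blockLanguage.2 ⟨w, hw, rfl⟩, _, mem_blockLanguage.2 ⟨v, hv, rfl⟩, rfl⟩
  · rintro ⟨s, hs, t, ht, rfl⟩
    obtain ⟨w, hw, rfl⟩ := mem_blockLanguage.1 hs
    obtain ⟨v, hv, rfl⟩ := mem_blockLanguage.1 ht
    exact ⟨w, v, hw, hv, rfl⟩

theorem tailLanguage_unfold (g : GatheringEntry A) (m : RawTail A) :
    tailLanguage (g.unfold m) =
      tailLanguage (lowerPart g.1.1) * tailLanguage m * tailLanguage (upperPart g.1.2) * {g.2} := by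
  simp [GatheringEntry.unfold, mul_assoc]

theorem mem_richMiddle_star {as z w : List A} (hz : ∀ c ∈ z, c ∈ as)
    (h : w ∈ tailLanguage (richMiddle as z)) : ∀ a ∈ w, a ∈ as := by
  induction z generalizing w with
  | nil =>
    simp only [richMiddle, List.map_nil, List.nil_append] at h
    obtain ⟨s, t, hs, rfl, rfl⟩ := mem_tailLanguage_cons_star.1 h
    simpa using hs
  | cons c z ih =>
    simp only [richMiddle, List.map_cons, List.cons_append] at h
    obtain ⟨s, t, hs, ht, rfl⟩ := mem_tailLanguage_cons_star.1 h
    have := ih (fun c hc => hz c (by simp [hc])) ht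
    have hc := hz c (by simp)
    intro a ha
    simp only [List.mem_append, List.mem_singleton] at ha
    rcases ha with (ha | rfl) | ha
    exacts [hs a ha, hc, this a ha]

theorem mem_cyclePow {N : ℕ} {as : List A} {c : A} (h : c ∈ cyclePow N as) : c ∈ as := by
  simp only [cyclePow, List.mem_flatten, List.mem_replicate] at h
  obtain ⟨l, ⟨-, rfl⟩, h⟩ := h
  exact h

/-- The number of bubbles with exactly `k` letters. -/
def sizeCount (k : ℕ) (l : RawTail A) : ℕ := l.countP fun p => RawBubble.size p.1 = k

theorem size_lowerPart {as : List A} {p : RawBubble A × List A} (h : p ∈ lowerPart as) :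
    RawBubble.size p.1 < as.length := by
  have key : ∀ (as pre : List A), ∀ p ∈ lowerFrom pre as,
      RawBubble.size p.1 < pre.length + as.length := by
    intro as
    induction as with
    | nil => simp [lowerFrom]
    | cons a as ih =>
      intro pre p hp
      simp only [lowerFrom, List.mem_cons] at hp
      rcases hp with rfl | hp
      · simp [RawBubble.size]
      · have := ih _ p hp
        simp at this ⊢
        omega
  simpa using key as [] p (lowerPart_eq as ▸ h)

theorem size_upperPart {bs : List A} {p : RawBubble A × List A} (h : p ∈ upperPart bs) :
    RawBubble.size p.1 < bs.length := by
  induction bs with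
  | nil => simp [upperPart] at h
  | cons b bs ih =>
    simp only [upperPart, List.mem_cons] at h
    rcases h with rfl | rfl | h
    · simp [RawBubble.size]
    · simp [RawBubble.size]
    · have := ih h
      simp
      omega

variable [DecidableEq A]

theorem mem_poorMiddles_star {as z w : List A} {m : RawTail A} (hz : ∀ c ∈ z, c ∈ as)
    (hm : m ∈ poorMiddles as z) (h : w ∈ tailLanguage m) : ∀ a ∈ w, a ∈ as := by
  induction z generalizing w m with
  | nil => simp [poorMiddles] at hm
  | cons c z ih =>
    simp only [poorMiddles, List.mem_cons, List.mem_map] at hm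
    rcases hm with rfl | ⟨m, hm, rfl⟩
    · obtain ⟨s, t, hs, rfl, rfl⟩ := mem_tailLanguage_cons_star.1 h
      intro a ha
      exact List.mem_of_mem_filter (hs a (by simpa using ha))
    · obtain ⟨s, t, hs, ht, rfl⟩ := mem_tailLanguage_cons_star.1 h
      have := ih (fun c hc => hz c (by simp [hc])) hm ht
      have hc := hz c (by simp)
      intro a ha
      simp only [List.mem_append, List.mem_singleton] at ha
      rcases ha with (ha | rfl) | ha
      exacts [List.mem_of_mem_filter (hs a ha), hc, this a ha]

/-- The greedy match of a word over `as` with `z` succeeds or stops somewhere. -/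
theorem star_subset_middles {as z w : List A} (hw : ∀ a ∈ w, a ∈ as) :
    w ∈ tailLanguage (richMiddle as z) ∨ ∃ m ∈ poorMiddles as z, w ∈ tailLanguage m := by
  induction z generalizing w with
  | nil =>
    left
    exact mem_tailLanguage_cons_star.2 ⟨w, [], hw, rfl, by simp⟩
  | cons c z ih =>
    by_cases hc : c ∈ w
    · obtain ⟨s, t, rfl, hs⟩ := List.eq_append_cons_of_mem hc
      rcases ih (w := t) (fun a ha => hw a (by simp [ha])) with h | ⟨m, hm, h⟩
      · left
        exact mem_tailLanguage_cons_star.2 ⟨s, t, fun a ha => hw a (by simp [ha]), h, by simp⟩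
      · right
        refine ⟨_, List.mem_cons_of_mem _ (List.mem_map_of_mem hm),
          mem_tailLanguage_cons_star.2 ⟨s, t, fun a ha => ?_, h, by simp⟩⟩
        rw [List.mem_filter]
        exact ⟨hw a (by simp [ha]), by simpa using fun h : a = c => hs (h ▸ ha)⟩
    · right
      refine ⟨_, List.mem_cons_self, mem_tailLanguage_cons_star.2 ⟨w, [], fun a ha => ?_, rfl,
        by simp⟩⟩
      rw [List.mem_filter]
      exact ⟨hw a ha, by simpa using fun h : a = c => hc (h ▸ ha)⟩

theorem gathering_decomposition {g : GatheringEntry A} (hn : g.1.1.Nodup) (hp : g.1.1.Perm g.1.2)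
    (N : ℕ) (w : List A) :
    w ∈ RawBubble.language g.toRaw.1 * ({g.toRaw.2} : Language A) ↔
      w ∈ tailLanguage (g.unfold (richMiddle g.1.1 (cyclePow N g.1.1))) ∨
      ∃ m ∈ poorMiddles g.1.1 (cyclePow N g.1.1), w ∈ tailLanguage (g.unfold m) := by
  have e : RawBubble.language g.toRaw.1 * ({g.toRaw.2} : Language A) =
      tailLanguage (lowerPart g.1.1) * RawBubble.language (.inl g.1.1 : RawBubble A) *
        tailLanguage (upperPart g.1.2) * {g.2} := by
    rw [← gatheringLanguage_eq hn hp]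
    rfl
  have key : ∀ M : Language A, w ∈ tailLanguage (lowerPart g.1.1) * M *
        tailLanguage (upperPart g.1.2) * {g.2} ↔ ∃ p q r, p ∈ tailLanguage (lowerPart g.1.1) ∧
        q ∈ M ∧ r ∈ tailLanguage (upperPart g.1.2) ∧ w = p ++ q ++ r ++ g.2 := by
    intro M
    constructor
    · rintro ⟨_, ⟨_, ⟨p, hp, q, hq, rfl⟩, r, hr, rfl⟩, _, rfl, rfl⟩
      exact ⟨p, q, r, hp, hq, hr, rfl⟩
    · rintro ⟨p, q, r, hp, hq, hr, rfl⟩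
      exact ⟨_, ⟨_, ⟨p, hp, q, hq, rfl⟩, r, hr, rfl⟩, _, rfl, rfl⟩
  rw [e]
  simp only [tailLanguage_unfold, key]
  constructor
  · rintro ⟨p, q, r, hp, hq, hr, rfl⟩
    rcases star_subset_middles (z := cyclePow N g.1.1) hq with h | ⟨m, hm, h⟩
    · exact Or.inl ⟨p, q, r, hp, h, hr, rfl⟩
    · exact Or.inr ⟨m, hm, p, q, r, hp, h, hr, rfl⟩
  · rintro (⟨p, q, r, hp, hq, hr, rfl⟩ | ⟨m, hm, p, q, r, hp, hq, hr, rfl⟩)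
    · exact ⟨p, q, r, hp, mem_richMiddle_star (fun _ => mem_cyclePow) hq, hr, rfl⟩
    · exact ⟨p, q, r, hp, mem_poorMiddles_star (fun _ => mem_cyclePow) hm hq, hr, rfl⟩

theorem tail_decomposition {l : List (GatheringEntry A)}
    (hl : ∀ g ∈ l, g.1.1.Nodup ∧ g.1.1.Perm g.1.2) (N : ℕ) (w : List A) :
    w ∈ tailLanguage (l.map GatheringEntry.toRaw) ↔
      w ∈ tailLanguage (richTail N l) ∨ ∃ t ∈ poorTails N l, w ∈ tailLanguage t := by
  induction l generalizing w with
  | nil => simp [richTail, poorTails]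
  | cons g l ih =>
    have ih := ih (fun g hg => hl g (by simp [hg]))
    have hg := gathering_decomposition (hl g (by simp)).1 (hl g (by simp)).2 N
    simp only [richTail, List.flatMap_cons, tailLanguage_append, poorTails, List.map_cons,
      tailLanguage_cons, List.mem_append, List.mem_map]
    constructor
    · rintro ⟨p, hp, q, hq, rfl⟩
      rcases (ih q).1 hq with h | ⟨t, ht, h⟩
      · rcases (hg p).1 hp with h' | ⟨m, hm, h'⟩
        · exact Or.inl ⟨p, h', q, h, rfl⟩
        · exact Or.inr ⟨_, Or.inl ⟨m, hm, rfl⟩, by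
            rw [tailLanguage_append]; exact ⟨p, h', q, hq, rfl⟩⟩
      · exact Or.inr ⟨_, Or.inr ⟨t, ht, rfl⟩, by
          rw [tailLanguage_cons]; exact ⟨p, hp, q, h, rfl⟩⟩
    · rintro (⟨p, hp, q, hq, rfl⟩ | ⟨_, ⟨m, hm, rfl⟩ | ⟨t, ht, rfl⟩, h⟩)
      · exact ⟨p, (hg p).2 (Or.inl hp), q, (ih q).2 (Or.inl hq), rfl⟩
      · rw [tailLanguage_append] at h
        obtain ⟨p, hp, q, hq, rfl⟩ := h
        exact ⟨p, (hg p).2 (Or.inr ⟨m, hm, hp⟩), q, hq, rfl⟩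
      · rw [tailLanguage_cons] at h
        obtain ⟨p, hp, q, hq, rfl⟩ := h
        exact ⟨p, hp, q, (ih q).2 (Or.inr ⟨t, ht, hq⟩), rfl⟩

/-! ### Weights -/

theorem size_poorMiddles {as z : List A} {m : RawTail A} (hz : ∀ c ∈ z, c ∈ as)
    (hm : m ∈ poorMiddles as z) : ∀ p ∈ m, RawBubble.size p.1 < as.length := by
  induction z generalizing m with
  | nil => simp [poorMiddles] at hm
  | cons c z ih =>
    have hc : (as.filter fun a => a ≠ c).length < as.length :=
      List.length_filter_lt_length_iff_exists.2 ⟨c, hz c (by simp), by simp⟩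
    simp only [poorMiddles, List.mem_cons, List.mem_map] at hm
    rcases hm with rfl | ⟨m, hm, rfl⟩
    · simpa [RawBubble.size] using hc
    · intro p hp
      rcases List.mem_cons.1 hp with rfl | hp
      · exact hc
      · exact ih (fun c hc => hz c (by simp [hc])) hm p hp

theorem poorMiddles_ne_nil {as z : List A} {m : RawTail A} (hz : ∀ c ∈ z, c ∈ as)
    (hm : m ∈ poorMiddles as z) : 0 < as.length := by
  cases z with
  | nil => simp [poorMiddles] at hm
  | cons c z => exact List.length_pos_of_mem (hz c (by simp))

/-- With respect to the size of the gathering that is replaced, the weight drops; above it, nothing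
changes. -/
theorem sizeCount_poorTails {l : List (GatheringEntry A)} {N : ℕ}
    (hp : ∀ g ∈ l, g.1.1.Perm g.1.2) {t : RawTail A} (ht : t ∈ poorTails N l) :
    ∃ g ∈ l, 0 < g.1.1.length ∧
      sizeCount g.1.1.length t < sizeCount g.1.1.length (l.map GatheringEntry.toRaw) ∧
      ∀ k, g.1.1.length < k → sizeCount k t = sizeCount k (l.map GatheringEntry.toRaw) := by
  induction l generalizing t with
  | nil => simp [poorTails] at ht
  | cons g l ih =>
    simp only [poorTails, List.mem_append, List.mem_map] at ht
    rcases ht with ⟨m, hm, rfl⟩ | ⟨t, ht, rfl⟩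
    · have h0 := poorMiddles_ne_nil (fun _ => mem_cyclePow) hm
      have hlen : ∀ p ∈ g.unfold m, RawBubble.size p.1 < g.1.1.length := by
        intro p h
        simp only [GatheringEntry.unfold, List.mem_append, List.mem_singleton] at h
        rcases h with ((h | h) | h) | rfl
        · exact size_lowerPart h
        · exact size_poorMiddles (fun _ => mem_cyclePow) hm p h
        · exact (hp g (by simp)).length_eq ▸ size_upperPart h
        · exact h0
      have hc : ∀ k, g.1.1.length ≤ k → sizeCount k (g.unfold m) = 0 := by
        intro k hk
        rw [sizeCount, List.countP_eq_zero]
        intro p h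
        have := hlen p h
        simp
        omega
      refine ⟨g, by simp, h0, ?_, fun k hk => ?_⟩
      · have := hc _ le_rfl
        simp only [sizeCount, List.countP_append, List.map_cons, List.countP_cons] at this ⊢
        rw [this]
        simp [GatheringEntry.toRaw, RawBubble.size]
      · have := hc _ hk.le
        simp only [sizeCount, List.countP_append, List.map_cons, List.countP_cons] at this ⊢
        rw [this]
        simp [GatheringEntry.toRaw, RawBubble.size, hk.ne]
    · obtain ⟨g', hg', h0, h1, h2⟩ := ih (fun g hg => hp g (by simp [hg])) ht
      refine ⟨g', by simp [hg'], h0, ?_, fun k hk => ?_⟩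
      · simp only [sizeCount, List.map_cons, List.countP_cons] at h1 ⊢
        omega
      · have := h2 k hk
        simp only [sizeCount, List.map_cons, List.countP_cons] at this ⊢
        omega

end Languages

/-! ### Runs, prefix sums and support-monotone steps -/

section Runs

variable {d : ℕ} {S : Finset (Fin d → ℤ)}

/-- The total effect of a firing sequence on the coordinate `j`. -/
def effect (r : List (ℚ × S)) (j : Fin d) : ℚ :=
  (r.map fun e => e.1 * ((e.2 : Fin d → ℤ) j : ℚ)).sum

@[simp] theorem effect_nil (j : Fin d) : effect ([] : List (ℚ × S)) j = 0 := rfl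

@[simp] theorem effect_cons (e : ℚ × S) (r : List (ℚ × S)) (j : Fin d) :
    effect (e :: r) j = e.1 * ((e.2 : Fin d → ℤ) j : ℚ) + effect r j := by simp [effect]

@[simp] theorem effect_append (r r' : List (ℚ × S)) (j : Fin d) :
    effect (r ++ r') j = effect r j + effect r' j := by simp [effect]

/-- All firing fractions lie in `(0, 1]`. -/
def Fractions (r : List (ℚ × S)) : Prop := ∀ e ∈ r, 0 < e.1 ∧ e.1 ≤ 1

theorem run_iff {x y : Config d} {r : List (ℚ × S)} :
    Run x r y ↔ Fractions r ∧ (∀ r₁ r₂, r₁ ++ r₂ = r → ∀ j, 0 ≤ (x j : ℚ) + effect r₁ j) ∧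
      ∀ j, (y j : ℚ) = x j + effect r j := by
  induction r generalizing x with
  | nil =>
    simp only [Run, Fractions, List.append_eq_nil_iff]
    constructor
    · rintro rfl
      refine ⟨by simp, ?_, by simp⟩
      rintro r₁ r₂ ⟨rfl, rfl⟩ j
      simp
    · rintro ⟨-, -, h⟩
      ext j
      simpa using (h j).symm
  | cons e r ih =>
    obtain ⟨α, t⟩ := e
    simp only [Run, ih]
    constructor
    · rintro ⟨z, ⟨h0, h1, hz⟩, hf, hp, hy⟩
      refine ⟨?_, ?_, ?_⟩
      · intro e he
        rcases List.mem_cons.1 he with rfl | he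
        · exact ⟨h0, h1⟩
        · exact hf e he
      · intro r₁ r₂ h j
        rcases List.append_eq_cons_iff.1 h with ⟨rfl, -⟩ | ⟨r₃, rfl, h'⟩
        · simp
        · have := hp r₃ r₂ h'.symm j
          rw [hz] at this
          simp only [effect_cons]
          linarith
      · intro j
        rw [hy, hz, effect_cons]
        ring
    · rintro ⟨hf, hp, hy⟩
      have hz : ∀ j, 0 ≤ (x j : ℚ) + α * ((t : Fin d → ℤ) j : ℚ) := fun j => by
        simpa using hp [(α, t)] r rfl j
      refine ⟨fun j => ⟨_, hz j⟩, ⟨(hf (α, t) (by simp)).1, (hf (α, t) (by simp)).2, fun j => rfl⟩,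
        fun e he => hf e (by simp [he]), fun r₁ r₂ h j => ?_, fun j => ?_⟩
      · have := hp ((α, t) :: r₁) r₂ (by simp [h]) j
        simp only [effect_cons] at this
        show 0 ≤ (x j : ℚ) + α * ((t : Fin d → ℤ) j : ℚ) + _
        linarith
      · show _ = (x j : ℚ) + α * ((t : Fin d → ℤ) j : ℚ) + _
        rw [hy, effect_cons]
        simp only
        ring

theorem mem_transitionLanguage {x y : Config d} {w : List S} :
    w ∈ transitionLanguage S x y ↔ ∃ r : List (ℚ × S), r.map Prod.snd = w ∧ Run x r y := by
  constructor
  · rintro ⟨α, hα, h⟩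
    exact ⟨_, List.map_snd_zip hα.ge, h⟩
  · rintro ⟨r, rfl, h⟩
    refine ⟨r.map Prod.fst, by simp, ?_⟩
    have e := List.zip_of_prod (rfl : r.map Prod.fst = _) (rfl : r.map Prod.snd = _)
    rwa [← e]

/-- A letter together with two flags. The first flag demands that the firing of the letter does
not shrink the support of the configuration, the second that it does not enlarge it. -/
abbrev Flagged (A : Type) : Type := (Bool × Bool) × A

/-- The word `u` with the flags `m` on each letter. -/
def flag {A : Type} (m : Bool × Bool) (u : List A) : List (Flagged A) := u.map fun a => (m, a)

/-- The configurations `x` and `y` can be connected by a run that reads the letters of the list and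
respects their flags. -/
def FlaggedRun : Config d → List (Flagged S) → Config d → Prop
  | x, [], y => x = y
  | x, e :: m, y => ∃ (α : ℚ) (z : Config d), Step x α (e.2 : Fin d → ℤ) z ∧
      (e.1.1 = true → ∀ j, x j ≠ 0 → z j ≠ 0) ∧ (e.1.2 = true → ∀ j, z j ≠ 0 → x j ≠ 0) ∧
      FlaggedRun z m y

theorem flaggedRun_append {x y : Config d} {m m' : List (Flagged S)} :
    FlaggedRun x (m ++ m') y ↔ ∃ z, FlaggedRun x m z ∧ FlaggedRun z m' y := by
  induction m generalizing x with
  | nil => simp [FlaggedRun]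
  | cons e m ih =>
    simp only [List.cons_append, FlaggedRun, ih]
    constructor
    · rintro ⟨α, z, hz, h1, h2, u, hu, h⟩
      exact ⟨u, ⟨α, z, hz, h1, h2, hu⟩, h⟩
    · rintro ⟨u, ⟨α, z, hz, h1, h2, hu⟩, h⟩
      exact ⟨α, z, hz, h1, h2, u, hu, h⟩

theorem flaggedRun_plain {x y : Config d} {w : List S} :
    FlaggedRun x (flag (false, false) w) y ↔ w ∈ transitionLanguage S x y := by
  rw [mem_transitionLanguage]
  induction w generalizing x with
  | nil =>
    constructor
    · intro h
      exact ⟨[], rfl, h⟩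
    · rintro ⟨r, hr, h⟩
      obtain rfl := List.map_eq_nil_iff.1 hr
      exact h
  | cons a w ih =>
    simp only [flag] at ih
    simp only [flag, List.map_cons, FlaggedRun, ih]
    constructor
    · rintro ⟨α, z, hz, -, -, r, hr, h⟩
      exact ⟨(α, a) :: r, by simp [hr], z, hz, h⟩
    · rintro ⟨r, hr, h⟩
      obtain ⟨⟨α, b⟩, r, rfl, rfl, hr'⟩ := List.map_eq_cons_iff.1 hr
      obtain ⟨z, hz, h⟩ := h
      exact ⟨α, z, hz, by simp, by simp, r, hr', h⟩

theorem transitionLanguage_append {x y z : Config d} {u v : List S}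
    (hu : u ∈ transitionLanguage S x y) (hv : v ∈ transitionLanguage S y z) :
    u ++ v ∈ transitionLanguage S x z := by
  rw [← flaggedRun_plain] at *
  rw [flag, List.map_append]
  exact flaggedRun_append.2 ⟨y, hu, hv⟩

/-! ### Robust runs and the insertion of letters -/

/-- The coordinate `j` is changed by some letter of the firing sequence. -/
def Touched (r : List (ℚ × S)) (j : Fin d) : Prop := ∃ e ∈ r, (e.2 : Fin d → ℤ) j ≠ 0

/-- `w` labels a run from `x` to `y` in which a coordinate is positive whenever it has been changed
before and will be changed again. Such runs survive small perturbations of the fractions. -/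
def RobustRun (x : Config d) (w : List S) (y : Config d) : Prop :=
  ∃ r : List (ℚ × S), r.map Prod.snd = w ∧ Fractions r ∧ (∀ j, (y j : ℚ) = x j + effect r j) ∧
    ∀ r₁ r₂, r₁ ++ r₂ = r → ∀ j, 0 ≤ (x j : ℚ) + effect r₁ j ∧
      (Touched r₁ j → Touched r₂ j → 0 < (x j : ℚ) + effect r₁ j)

theorem RobustRun.mem_transitionLanguage {x y : Config d} {w : List S} (h : RobustRun x w y) :
    w ∈ transitionLanguage S x y := by
  obtain ⟨r, hr, hf, hy, hp⟩ := h
  exact CVAS.mem_transitionLanguage.2 ⟨r, hr, run_iff.2 ⟨hf, fun r₁ r₂ h j => (hp r₁ r₂ h j).1, hy⟩⟩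

/-- Finitely many strict linear inequalities that hold at `0` hold for some small `ε > 0`. -/
theorem exists_small {ι : Type*} [Finite ι] (c k : ι → ℚ) (hc : ∀ i, 0 < c i) :
    ∃ ε : ℚ, 0 < ε ∧ ∀ i, ε * k i < c i := by
  have h : ∀ᶠ ε : ℚ in nhdsWithin 0 (Set.Ioi 0), ∀ i, ε * k i < c i := by
    rw [Filter.eventually_all]
    intro i
    have : Filter.Tendsto (fun ε : ℚ => ε * k i) (nhdsWithin 0 (Set.Ioi 0)) (nhds 0) := by
      have h : Filter.Tendsto (fun ε : ℚ => ε * k i) (nhds 0) (nhds (0 * k i)) :=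
        Filter.tendsto_id.mul_const _
      rw [zero_mul] at h
      exact h.mono_left nhdsWithin_le_nhds
    exact this.eventually_lt_const (hc i)
  obtain ⟨ε, h1, h2⟩ := (h.and self_mem_nhdsWithin).exists
  exact ⟨ε, h2, h1⟩

theorem touched_append {r r' : List (ℚ × S)} {j : Fin d} :
    Touched (r ++ r') j ↔ Touched r j ∨ Touched r' j := by
  simp [Touched, or_and_right, exists_or]

theorem touched_cons {e : ℚ × S} {r : List (ℚ × S)} {j : Fin d} :
    Touched (e :: r) j ↔ (e.2 : Fin d → ℤ) j ≠ 0 ∨ Touched r j := by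
  simp [Touched]

/-- A letter can be inserted at any place that lies between two of its occurrences: it is fired with
a small fraction, which an earlier occurrence gives up. -/
theorem RobustRun.insert {x y : Config d} {w₁ w₂ : List S} {a : S} (h : RobustRun x (w₁ ++ w₂) y)
    (h1 : a ∈ w₁) (h2 : a ∈ w₂) : RobustRun x (w₁ ++ a :: w₂) y := by
  obtain ⟨r, hr, hf, hy, hp⟩ := h
  obtain ⟨q₁, r₂, rfl, rfl, rfl⟩ := List.map_eq_append_iff.1 hr
  obtain ⟨⟨β, _⟩, he, rfl⟩ := List.mem_map.1 h1
  obtain ⟨e₂, he₂, ha₂⟩ := List.mem_map.1 h2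
  obtain ⟨s₁, s₂, rfl⟩ := List.append_of_mem he
  simp only at ha₂ ⊢
  rename_i a
  have hβ := hf (β, a) (by simp)
  simp only at hβ
  have ht₂ : ∀ j, (a : Fin d → ℤ) j ≠ 0 → Touched r₂ j := fun j hj => ⟨e₂, he₂, by rwa [ha₂]⟩
  -- The configurations between the two occurrences, which have to stay non-negative.
  obtain ⟨ε, hε, hsmall⟩ := exists_small
    (ι := Option (Fin (s₂.length + 1) × {j : Fin d // (a : Fin d → ℤ) j ≠ 0}))
    (fun o => o.elim β fun i => (x i.2 : ℚ) + effect (s₁ ++ (β, a) :: s₂.take i.1) i.2)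
    (fun o => o.elim 1 fun i => ((a : Fin d → ℤ) i.2 : ℚ)) (by
      rintro (_ | ⟨i, j, hj⟩)
      · exact hβ.1
      · refine (hp (s₁ ++ (β, a) :: s₂.take i) (s₂.drop i ++ r₂) ?_ j).2 ⟨(β, a), by simp, hj⟩ ?_
        · simp only [List.append_assoc, List.cons_append, ← List.append_assoc (s₂.take i),
            List.take_append_drop]
        · exact touched_append.2 (Or.inr (ht₂ j hj)))
  have hεβ : ε < β := by simpa using hsmall none
  have hmid : ∀ s₃ s₄, s₃ ++ s₄ = s₂ → ∀ j, (a : Fin d → ℤ) j ≠ 0 →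
      ε * ((a : Fin d → ℤ) j : ℚ) < x j + effect (s₁ ++ (β, a) :: s₃) j := by
    rintro s₃ s₄ rfl j hj
    have := hsmall (some (⟨s₃.length, by simp⟩, ⟨j, hj⟩))
    simpa using this
  have hmid' : ∀ s₃ s₄, s₃ ++ s₄ = s₂ → ∀ j,
      0 ≤ (x j : ℚ) + effect (s₁ ++ (β - ε, a) :: s₃) j ∧
      (Touched (s₁ ++ (β, a) :: s₃) j → Touched (s₄ ++ r₂) j →
        0 < (x j : ℚ) + effect (s₁ ++ (β - ε, a) :: s₃) j) := by
    intro s₃ s₄ h j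
    have e : effect (s₁ ++ (β - ε, a) :: s₃) j =
        effect (s₁ ++ (β, a) :: s₃) j - ε * ((a : Fin d → ℤ) j : ℚ) := by
      simp only [effect_append, effect_cons]
      ring
    rw [e]
    by_cases hj : (a : Fin d → ℤ) j = 0
    · have := hp (s₁ ++ (β, a) :: s₃) (s₄ ++ r₂) (by simp [← h]) j
      simpa [hj] using this
    · have := hmid s₃ s₄ h j hj
      exact ⟨by linarith, fun _ _ => by linarith⟩
  refine ⟨s₁ ++ (β - ε, a) :: s₂ ++ (ε, a) :: r₂, by simp, ?_, ?_, ?_⟩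
  · intro e he
    simp only [List.append_assoc, List.cons_append, List.mem_append, List.mem_cons] at he
    rcases he with he | rfl | he | rfl | he
    · exact hf e (by simp [he])
    · exact ⟨by simpa using hεβ, by simp only; linarith⟩
    · exact hf e (by simp [he])
    · exact ⟨hε, by simp only; linarith⟩
    · exact hf e (by simp [he])
  · intro j
    rw [hy]
    simp only [effect_append, effect_cons]
    ring
  · intro r₁ r₃ h j
    rcases List.append_eq_append_iff.1 h with ⟨q, h, h'⟩ | ⟨q, h, h'⟩
    · -- The prefix ends before the inserted letter.
      rcases List.append_eq_append_iff.1 h with ⟨q', h3, h4⟩ | ⟨q', h3, h4⟩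
      · rcases List.cons_eq_append_iff.1 h4 with ⟨rfl, h5⟩ | ⟨s₃, rfl, h5⟩
        · have := hp r₁ ((β, a) :: s₂ ++ r₂) (by simp [h3]) j
          refine ⟨this.1, fun t1 t2 => this.2 t1 ?_⟩
          rw [h', h5] at t2
          simp only [touched_append, touched_cons] at t2 ⊢
          tauto
        · obtain ⟨m1, m2⟩ := hmid' s₃ q h5.symm j
          rw [h3]
          refine ⟨m1, fun t1 t2 => m2 ?_ ?_⟩
          · simpa only [touched_append, touched_cons, h3] using t1
          · rw [h'] at t2
            have := ht₂ j
            simp only [touched_append, touched_cons] at t2 ⊢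
            tauto
      · have := hp r₁ (q' ++ (β, a) :: s₂ ++ r₂) (by simp [h3]) j
        refine ⟨this.1, fun t1 t2 => this.2 t1 ?_⟩
        rw [h', h4] at t2
        simp only [touched_append, touched_cons] at t2 ⊢
        tauto
    · rcases List.cons_eq_append_iff.1 h' with ⟨rfl, h5⟩ | ⟨s₃, rfl, h5⟩
      · obtain ⟨m1, m2⟩ := hmid' s₂ [] (by simp) j
        rw [h, List.append_nil]
        refine ⟨m1, fun t1 t2 => m2 ?_ ?_⟩
        · simpa only [touched_append, touched_cons] using t1
        · rw [h5] at t2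
          have := ht₂ j
          simp only [touched_cons, List.nil_append] at t2 ⊢
          tauto
      · -- The prefix contains the inserted letter, so the two changes cancel.
        have := hp (s₁ ++ (β, a) :: s₂ ++ s₃) r₃ (by simp [h5]) j
        have e : effect r₁ j = effect (s₁ ++ (β, a) :: s₂ ++ s₃) j := by
          rw [h]
          simp only [effect_append, effect_cons]
          ring
        rw [e]
        refine ⟨this.1, fun t1 t2 => this.2 ?_ t2⟩
        rw [h] at t1
        simp only [touched_append, touched_cons] at t1 ⊢
        tauto

theorem RobustRun.insert_word {x y : Config d} {w₁ w₂ v : List S} (h : RobustRun x (w₁ ++ w₂) y)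
    (hv : ∀ a ∈ v, a ∈ w₁ ∧ a ∈ w₂) : RobustRun x (w₁ ++ v ++ w₂) y := by
  induction v with
  | nil => simpa using h
  | cons a v ih =>
    have := ih fun b hb => hv b (by simp [hb])
    rw [List.append_assoc] at this
    have := this.insert (hv a (by simp)).1 (List.mem_append_right v (hv a (by simp)).2)
    simpa using this

/-- The words between the bubbles. -/
def skeleton {A : Type} (l : RawTail A) : List A := l.flatMap fun p => p.2

theorem skeleton_append {A : Type} (l l' : RawTail A) :
    skeleton (l ++ l') = skeleton l ++ skeleton l' := by simp [skeleton]

/-- In `w₁ l w₂`, all bubbles of `l` are stars, and each of their letters occurs both before and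
after the bubble in the fixed parts of the expression. -/
def Insertable {A : Type} (w₁ : List A) : RawTail A → List A → Prop
  | [], _ => True
  | (.inl B, u) :: l, w₂ =>
    (∀ a ∈ B, a ∈ w₁ ∧ a ∈ u ++ skeleton l ++ w₂) ∧ Insertable (w₁ ++ u) l w₂
  | (.inr _, _) :: _, _ => False

theorem Insertable.mono {A : Type} {w₁ w₁' w₂ : List A} {l : RawTail A} (h : Insertable w₁ l w₂)
    (hw : w₁ ⊆ w₁') : Insertable w₁' l w₂ := by
  induction l generalizing w₁ w₁' with
  | nil => trivial
  | cons p l ih =>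
    obtain ⟨B | g, u⟩ := p
    · refine ⟨fun a ha => ⟨hw (h.1 a ha).1, (h.1 a ha).2⟩, ih h.2 ?_⟩
      exact List.append_subset.2 ⟨fun a ha => by simp [hw ha], fun a ha => by simp [ha]⟩
    · exact h

theorem insertable_append {A : Type} {w₁ w₂ : List A} {l l' : RawTail A} :
    Insertable w₁ (l ++ l') w₂ ↔ Insertable w₁ l (skeleton l' ++ w₂) ∧
      Insertable (w₁ ++ skeleton l) l' w₂ := by
  induction l generalizing w₁ with
  | nil => simp [Insertable, skeleton]
  | cons p l ih =>
    obtain ⟨B | g, u⟩ := p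
    · simp only [List.cons_append, Insertable, ih, skeleton, List.flatMap_cons, List.flatMap_append,
        List.append_assoc, and_assoc]
    · simp [Insertable]

/-- If the word without the bubbles labels a robust run, then every star of an insertable tail may
be filled with an arbitrary word over its letters. -/
theorem RobustRun.insert_tail {x y : Config d} {w₁ w₂ w : List S} {l : RawTail S}
    (h : RobustRun x (w₁ ++ skeleton l ++ w₂) y) (hl : Insertable w₁ l w₂)
    (hw : w ∈ tailLanguage l) : RobustRun x (w₁ ++ w ++ w₂) y := by
  induction l generalizing w₁ w with
  | nil =>
    obtain rfl : w = [] := hw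
    simpa [skeleton] using h
  | cons p l ih =>
    obtain ⟨B | g, u⟩ := p
    · obtain ⟨s, t, hs, ht, rfl⟩ := mem_tailLanguage_cons_star.1 hw
      have h' : RobustRun x (w₁ ++ (u ++ skeleton l ++ w₂)) y := by
        simpa [skeleton] using h
      have := h'.insert_word (v := s) fun a ha => hl.1 a (hs a ha)
      have := ih (w₁ := w₁ ++ s ++ u) (w := t) (by simpa using this)
        (hl.2.mono (by
          refine List.append_subset.2 ⟨fun a ha => ?_, fun a ha => ?_⟩ <;> simp [ha])) ht
      simpa using this
    · exact hl.elim

theorem skeleton_upperPart {A : Type} (bs : List A) : skeleton (upperPart bs) = bs := by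
  induction bs with
  | nil => rfl
  | cons b bs ih =>
    simp only [skeleton] at ih
    simp [upperPart, skeleton, ih]

theorem insertable_lowerFrom {A : Type} (as pre w₁ w₂ : List A) (h1 : pre ⊆ w₁)
    (h2 : pre ++ as ⊆ w₂) : Insertable w₁ (lowerFrom pre as) w₂ := by
  induction as generalizing pre w₁ with
  | nil => trivial
  | cons a as ih =>
    refine ⟨fun b hb => ⟨h1 hb, ?_⟩, ih _ _ ?_ (by simpa using h2)⟩
    · have := h2 (List.mem_append_left _ hb)
      simp [this]
    · refine List.append_subset.2 ⟨fun a ha => by simp [h1 ha], fun a ha => by simp_all⟩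

theorem insertable_upperPart {A : Type} (bs w₁ w₂ : List A) (h : bs ⊆ w₁) :
    Insertable w₁ (upperPart bs) w₂ := by
  induction bs generalizing w₁ with
  | nil => trivial
  | cons b bs ih =>
    have hbs : bs ⊆ w₁ := fun a ha => h (by simp [ha])
    refine ⟨by simp, fun a ha => ⟨by simp [hbs ha], ?_⟩, ih _ fun a ha => by simp [hbs ha]⟩
    rw [skeleton_upperPart]
    simp [ha]

theorem skeleton_lowerPart {A : Type} (as : List A) : skeleton (lowerPart as) = as := by
  rw [lowerPart_eq]
  generalize ([] : List A) = pre
  induction as generalizing pre with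
  | nil => rfl
  | cons b bs ih =>
    simp only [skeleton] at ih
    simp [lowerFrom, skeleton, ih]

theorem skeleton_richMiddle {A : Type} (as z : List A) : skeleton (richMiddle as z) = z := by
  simp [skeleton, richMiddle, List.flatMap_map]

theorem insertable_richMiddle {A : Type} (as z w₁ w₂ : List A) (h1 : as ⊆ w₁) (h2 : as ⊆ w₂) :
    Insertable w₁ (richMiddle as z) w₂ := by
  induction z generalizing w₁ with
  | nil => exact ⟨fun a ha => ⟨h1 ha, by simp [h2 ha]⟩, trivial⟩
  | cons c z ih =>
    exact ⟨fun a ha => ⟨h1 ha, by simp [h2 ha]⟩, ih _ fun a ha => by simp [h1 ha]⟩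

/-- In a run whose steps do not shrink the support, a coordinate is positive once it has been
changed. -/
theorem FlaggedRun.exists_up {x y : Config d} {u : List S}
    (h : FlaggedRun x (flag (true, false) u) y) :
    ∃ r : List (ℚ × S), r.map Prod.snd = u ∧ Fractions r ∧ (∀ j, (y j : ℚ) = x j + effect r j) ∧
      ∀ r₁ r₂, r₁ ++ r₂ = r → ∀ j, 0 ≤ (x j : ℚ) + effect r₁ j ∧
        (Touched r₁ j ∨ x j ≠ 0 → 0 < (x j : ℚ) + effect r₁ j) := by
  induction u generalizing x with
  | nil =>
    obtain rfl : x = y := h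
    refine ⟨[], rfl, by simp [Fractions], by simp, fun r₁ r₂ h j => ?_⟩
    obtain ⟨rfl, rfl⟩ := List.append_eq_nil_iff.1 h
    simp [Touched, pos_iff_ne_zero]
  | cons a u ih =>
    obtain ⟨α, z, ⟨h0, h1, hz⟩, hup, -, h⟩ := h
    obtain ⟨r, hr, hf, hy, hp⟩ := ih h
    have hup := hup rfl
    refine ⟨(α, a) :: r, by simp [hr], ?_, fun j => ?_, fun r₁ r₂ h j => ?_⟩
    · intro e he
      rcases List.mem_cons.1 he with rfl | he
      · exact ⟨h0, h1⟩
      · exact hf e he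
    · rw [hy, hz, effect_cons]
      simp only
      ring
    · rcases List.append_eq_cons_iff.1 h with ⟨rfl, -⟩ | ⟨r₃, rfl, h'⟩
      · simp [Touched, pos_iff_ne_zero]
      · obtain ⟨p1, p2⟩ := hp r₃ r₂ h'.symm j
        have e : (x j : ℚ) + effect ((α, a) :: r₃) j = z j + effect r₃ j := by
          rw [hz, effect_cons]
          simp only
          ring
        rw [e]
        refine ⟨p1, fun t => p2 ?_⟩
        rw [touched_cons] at t
        rcases t with (t | t) | t
        · right
          by_cases hx : x j = 0
          · intro hz0
            have := hz j
            simp only [hz0, hx, NNRat.cast_zero, zero_add] at this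
            have := this.symm
            simp only [mul_eq_zero, h0.ne', false_or, Int.cast_eq_zero] at this
            exact t this
          · exact hup j hx
        · exact Or.inl t
        · exact Or.inr (hup j t)

/-- In a run whose steps do not enlarge the support, a coordinate is positive as long as it will be
changed again. -/
theorem FlaggedRun.exists_down {x y : Config d} {u : List S}
    (h : FlaggedRun x (flag (false, true) u) y) :
    ∃ r : List (ℚ × S), r.map Prod.snd = u ∧ Fractions r ∧ (∀ j, (y j : ℚ) = x j + effect r j) ∧
      ∀ r₁ r₂, r₁ ++ r₂ = r → ∀ j, 0 ≤ (x j : ℚ) + effect r₁ j ∧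
        (Touched r₂ j → 0 < (x j : ℚ) + effect r₁ j) := by
  induction u generalizing x with
  | nil =>
    obtain rfl : x = y := h
    refine ⟨[], rfl, by simp [Fractions], by simp, fun r₁ r₂ h j => ?_⟩
    obtain ⟨rfl, rfl⟩ := List.append_eq_nil_iff.1 h
    simp [Touched]
  | cons a u ih =>
    obtain ⟨α, z, ⟨h0, h1, hz⟩, -, hdown, h⟩ := h
    obtain ⟨r, hr, hf, hy, hp⟩ := ih h
    have hdown := hdown rfl
    refine ⟨(α, a) :: r, by simp [hr], ?_, fun j => ?_, fun r₁ r₂ h j => ?_⟩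
    · intro e he
      rcases List.mem_cons.1 he with rfl | he
      · exact ⟨h0, h1⟩
      · exact hf e he
    · rw [hy, hz, effect_cons]
      simp only
      ring
    · rcases List.append_eq_cons_iff.1 h with ⟨rfl, rfl⟩ | ⟨r₃, rfl, h'⟩
      · simp only [effect_nil, add_zero, NNRat.cast_nonneg, true_and, touched_cons,
          NNRat.cast_pos, pos_iff_ne_zero]
        rintro (t | t)
        · intro hx
          have hz0 : z j = 0 := by
            by_contra hne
            exact hdown j hne hx
          have := hz j
          simp only [hz0, hx, NNRat.cast_zero, zero_add] at this
          have := this.symm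
          simp only [mul_eq_zero, h0.ne', false_or, Int.cast_eq_zero] at this
          exact t this
        · have := (hp [] r rfl j).2 t
          simp only [effect_nil, add_zero, NNRat.cast_pos] at this
          exact hdown j this.ne'
      · have e : (x j : ℚ) + effect ((α, a) :: r₃) j = z j + effect r₃ j := by
          rw [hz, effect_cons]
          simp only
          ring
        rw [e]
        exact hp r₃ r₂ h'.symm j

theorem RobustRun.of_up_down {x y z : Config d} {u v : List S}
    (hu : FlaggedRun x (flag (true, false) u) z) (hv : FlaggedRun z (flag (false, true) v) y) :
    RobustRun x (u ++ v) y := by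
  obtain ⟨r, rfl, hf, hz, hp⟩ := hu.exists_up
  obtain ⟨r', rfl, hf', hy, hp'⟩ := hv.exists_down
  refine ⟨r ++ r', by simp, ?_, fun j => by rw [hy, hz, effect_append]; ring, fun r₁ r₂ h j => ?_⟩
  · intro e he
    rcases List.mem_append.1 he with he | he
    exacts [hf e he, hf' e he]
  · rcases List.append_eq_append_iff.1 h with ⟨q, h', -⟩ | ⟨q, rfl, h'⟩
    · have := hp r₁ q h'.symm j
      exact ⟨this.1, fun t _ => this.2 (Or.inl t)⟩
    · have := hp' q r₂ h'.symm j
      rw [hz] at this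
      rw [effect_append, ← add_assoc]
      exact ⟨this.1, fun _ t => this.2 t⟩

/-- The run that witnesses that all words of `richTail N l` label runs. -/
def flagTail {A : Type} (N : ℕ) (l : List (GatheringEntry A)) : List (Flagged A) :=
  l.flatMap fun g => flag (true, false) (g.1.1 ++ cyclePow N g.1.1) ++ flag (false, true) g.1.2 ++
    flag (false, false) g.2

/-- The letters of the stars of `richTail N l` are inserted into the run of `flagTail N l`, one
gathering at a time. -/
theorem richTail_subset {x y : Config d} {N : ℕ} {l : List (GatheringEntry S)}
    (hl : ∀ g ∈ l, g.1.1.Perm g.1.2) (h : FlaggedRun x (flagTail N l) y) {w : List S}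
    (hw : w ∈ tailLanguage (richTail N l)) : w ∈ transitionLanguage S x y := by
  induction l generalizing x w with
  | nil =>
    obtain rfl : w = [] := hw
    exact flaggedRun_plain.1 h
  | cons g l ih =>
    rw [flagTail, List.flatMap_cons, List.append_assoc, List.append_assoc] at h
    obtain ⟨p, hp, h⟩ := flaggedRun_append.1 h
    obtain ⟨q, hq, h⟩ := flaggedRun_append.1 h
    obtain ⟨s, hs, h⟩ := flaggedRun_append.1 h
    simp only [richTail, List.flatMap_cons, tailLanguage_append] at hw
    obtain ⟨w₁, hw₁, w₂, hw₂, rfl⟩ := hw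
    refine transitionLanguage_append ?_ (ih (fun g hg => hl g (by simp [hg])) h hw₂)
    rw [tailLanguage_unfold] at hw₁
    obtain ⟨w₁, hw₁, _, rfl, rfl⟩ := hw₁
    refine transitionLanguage_append ?_ (flaggedRun_plain.1 hs)
    have hperm := hl g (by simp)
    have := RobustRun.of_up_down hp hq
    rw [← tailLanguage_append, ← tailLanguage_append] at hw₁
    have := RobustRun.insert_tail (w₁ := []) (w₂ := []) (l := lowerPart g.1.1 ++
      richMiddle g.1.1 (cyclePow N g.1.1) ++ upperPart g.1.2) (x := x) (y := q) (w := w₁) ?_ ?_ hw₁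
    · simpa using this.mem_transitionLanguage
    · simpa [skeleton_append, skeleton_upperPart, skeleton_lowerPart, skeleton_richMiddle]
        using this
    · have hsub : g.1.1 ⊆ g.1.2 := hperm.subset
      rw [insertable_append, insertable_append]
      refine ⟨⟨?_, ?_⟩, ?_⟩
      · rw [lowerPart_eq]
        refine insertable_lowerFrom _ _ _ _ (by simp) ?_
        intro a ha
        simp [skeleton_upperPart, hsub (by simpa using ha)]
      · refine insertable_richMiddle _ _ _ _ ?_ ?_
        · simp [skeleton_lowerPart]
        · simpa [skeleton_upperPart] using hsub
      · refine insertable_upperPart _ _ _ fun a ha => ?_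
        have : a ∈ g.1.1 := hperm.mem_iff.2 ha
        simp [skeleton_append, skeleton_lowerPart, this]

end Runs

/-! ### Existence of a run through a long power of the letters -/

section Existence

variable {d : ℕ} {S : Finset (Fin d → ℤ)}

/-- The linear combination of the letters of `u` with coefficients `f`, at the coordinate `j`. -/
def combination (f : S → ℚ) (u : List S) (j : Fin d) : ℚ :=
  (u.map fun a => f a * ((a : Fin d → ℤ) j : ℚ)).sum

theorem combination_congr {f g : S → ℚ} {u : List S} (h : ∀ a ∈ u, f a = g a) (j : Fin d) :
    combination f u j = combination g u j := by
  unfold combination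
  congr 1
  exact List.map_congr_left fun a ha => by rw [h a ha]

@[simp] theorem combination_cons (f : S → ℚ) (a : S) (u : List S) (j : Fin d) :
    combination f (a :: u) j = f a * ((a : Fin d → ℤ) j : ℚ) + combination f u j := by
  simp [combination]

/-- If all coordinates that `t` decreases are positive, then a small multiple of `t` can be added
such that all coordinates which were positive or are changed become positive. -/
theorem exists_small_step (x : Config d) (t : Fin d → ℤ) (h : ∀ j, t j < 0 → x j ≠ 0) {ε : ℚ}
    (hε : 0 < ε) : ∃ (α : ℚ) (z : Config d), 0 < α ∧ α ≤ ε ∧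
      (∀ j, (z j : ℚ) = x j + α * (t j : ℚ)) ∧ ∀ j, x j ≠ 0 ∨ t j ≠ 0 → z j ≠ 0 := by
  obtain ⟨α, hα, hs⟩ := exists_small (ι := Option {j : Fin d // t j < 0})
    (fun o => o.elim ε fun i => (x i : ℚ)) (fun o => o.elim 1 fun i => -(t i : ℚ)) (by
      rintro (_ | ⟨j, hj⟩)
      · exact hε
      · exact NNRat.cast_pos.2 (pos_iff_ne_zero.2 (h j hj)))
  have hpos : ∀ j, x j ≠ 0 ∨ t j ≠ 0 → 0 < (x j : ℚ) + α * (t j : ℚ) := by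
    intro j hj
    have hx : (0 : ℚ) ≤ x j := NNRat.cast_nonneg _
    rcases lt_trichotomy (t j) 0 with ht | ht | ht
    · have := hs (some ⟨j, ht⟩)
      simp only [Option.elim] at this
      linarith
    · have : 0 < x j := pos_iff_ne_zero.2 (by simpa [ht] using hj)
      simpa [ht] using this
    · have : (0 : ℚ) < t j := by exact_mod_cast ht
      have := mul_pos hα this
      linarith
  have hnn : ∀ j, 0 ≤ (x j : ℚ) + α * (t j : ℚ) := by
    intro j
    by_cases hj : x j ≠ 0 ∨ t j ≠ 0
    · exact (hpos j hj).le
    · push Not at hj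
      simp [hj.1, hj.2]
  refine ⟨α, fun j => ⟨_, hnn j⟩, hα, ?_, fun j => rfl, fun j hj h0 => ?_⟩
  · have := hs none
    simp only [Option.elim, mul_one] at this
    exact this.le
  · have h1 := hpos j hj
    have h2 := congrArg (fun q : ℚ≥0 => (q : ℚ)) h0
    simp only [NNRat.cast_zero] at h2
    exact h1.ne' h2

/-- If every letter of `u` decreases only coordinates that are positive in `x` or increased by an
earlier letter, then `u` can be fired with small fractions such that all changed coordinates
become and remain positive. -/
theorem exists_up_run {u : List S} (hn : u.Nodup) {x : Config d}
    (h : ∀ (u₁ : List S) (a : S) (u₂ : List S), u = u₁ ++ a :: u₂ → ∀ j, (a : Fin d → ℤ) j < 0 →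
      x j ≠ 0 ∨ ∃ b ∈ u₁, 0 < (b : Fin d → ℤ) j) {ε : ℚ} (hε : 0 < ε) (hε1 : ε ≤ 1) :
    ∃ (f : S → ℚ) (z : Config d), (∀ a ∈ u, 0 < f a ∧ f a ≤ ε) ∧
      FlaggedRun x (flag (true, false) u) z ∧ (∀ j, (z j : ℚ) = x j + combination f u j) ∧
      ∀ j, (x j ≠ 0 ∨ ∃ a ∈ u, (a : Fin d → ℤ) j ≠ 0) → z j ≠ 0 := by
  classical
  induction u generalizing x with
  | nil => exact ⟨fun _ => 1, x, by simp, rfl, by simp [combination], by simp⟩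
  | cons a u ih =>
    obtain ⟨α, y, hα, hαε, hy, hy0⟩ := exists_small_step x a
      (fun j hj => by simpa using h [] a u rfl j hj) hε
    obtain ⟨f, z, hf, hr, hz, hz0⟩ := ih (List.nodup_cons.1 hn).2 (x := y) (by
      rintro u₁ b u₂ rfl j hj
      rcases h (a :: u₁) b u₂ rfl j hj with hx | ⟨c, hc, hcj⟩
      · exact Or.inl (hy0 j (Or.inl hx))
      · rcases List.mem_cons.1 hc with rfl | hc
        · exact Or.inl (hy0 j (Or.inr hcj.ne'))
        · exact Or.inr ⟨c, hc, hcj⟩)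
    have hne : ∀ b ∈ u, b ≠ a := fun b hb e => (List.nodup_cons.1 hn).1 (e ▸ hb)
    refine ⟨Function.update f a α, z, ?_, ⟨α, y, ⟨hα, hαε.trans hε1, hy⟩,
      fun _ j hj => hy0 j (Or.inl hj), by simp, hr⟩, fun j => ?_, fun j hj => ?_⟩
    · intro b hb
      rcases List.mem_cons.1 hb with rfl | hb
      · simpa using ⟨hα, hαε⟩
      · simpa [hne b hb] using hf b hb
    · have : combination (Function.update f a α) u j = combination f u j :=
        combination_congr (fun b hb => by simp [hne b hb]) j
      rw [hz, hy, combination_cons, this]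
      simp [add_assoc]
    · refine hz0 j ?_
      rcases hj with hj | ⟨b, hb, hj⟩
      · exact Or.inl (hy0 j (Or.inl hj))
      · rcases List.mem_cons.1 hb with rfl | hb
        · exact Or.inl (hy0 j (Or.inr hj))
        · exact Or.inr ⟨b, hb, hj⟩

/-- The mirror image of `exists_up_run`. -/
theorem exists_down_run {u : List S} (hn : u.Nodup) {y : Config d}
    (h : ∀ (u₁ : List S) (a : S) (u₂ : List S), u = u₁ ++ a :: u₂ → ∀ j, 0 < (a : Fin d → ℤ) j →
      y j ≠ 0 ∨ ∃ b ∈ u₂, (b : Fin d → ℤ) j < 0) {ε : ℚ} (hε : 0 < ε) (hε1 : ε ≤ 1) :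
    ∃ (f : S → ℚ) (z : Config d), (∀ a ∈ u, 0 < f a ∧ f a ≤ ε) ∧
      FlaggedRun z (flag (false, true) u) y ∧ (∀ j, (y j : ℚ) = z j + combination f u j) ∧
      ∀ j, (y j ≠ 0 ∨ ∃ a ∈ u, (a : Fin d → ℤ) j ≠ 0) → z j ≠ 0 := by
  classical
  induction u using List.reverseRecOn generalizing y with
  | nil => exact ⟨fun _ => 1, y, by simp, rfl, by simp [combination], by simp⟩
  | append_singleton u a ih =>
    obtain ⟨α, x, hα, hαε, hx, hx0⟩ := exists_small_step y (-a)
      (fun j hj => by simpa using h u a [] rfl j (by simpa using hj)) hε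
    simp only [Pi.neg_apply, Int.cast_neg, mul_neg, ne_eq, neg_eq_zero] at hx hx0
    have hna : a ∉ u ∧ u.Nodup := by
      rw [List.nodup_append_comm] at hn
      simpa using hn
    obtain ⟨f, z, hf, hr, hz, hz0⟩ := ih hna.2 (y := x) (by
      rintro u₁ b u₂ rfl j hj
      rcases h u₁ b (u₂ ++ [a]) (by simp) j hj with hx | ⟨c, hc, hcj⟩
      · exact Or.inl (hx0 j (Or.inl hx))
      · rcases List.mem_append.1 hc with hc | hc
        · exact Or.inr ⟨c, hc, hcj⟩
        · obtain rfl := List.mem_singleton.1 hc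
          exact Or.inl (hx0 j (Or.inr hcj.ne)))
    have hne : ∀ b ∈ u, b ≠ a := fun b hb e => hna.1 (e ▸ hb)
    refine ⟨Function.update f a α, z, ?_, ?_, fun j => ?_, fun j hj => ?_⟩
    · intro b hb
      rcases List.mem_append.1 hb with hb | hb
      · simpa [hne b hb] using hf b hb
      · obtain rfl := List.mem_singleton.1 hb
        simpa using ⟨hα, hαε⟩
    · rw [flag, List.map_append]
      refine flaggedRun_append.2 ⟨x, hr, α, y, ⟨hα, hαε.trans hε1, fun j => ?_⟩, by simp,
        fun _ j hj => hx0 j (Or.inl hj), rfl⟩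
      rw [hx]
      ring
    · have : combination (Function.update f a α) u j = combination f u j :=
        combination_congr (fun b hb => by simp [hne b hb]) j
      have e : combination (Function.update f a α) (u ++ [a]) j =
          combination (Function.update f a α) u j + α * ((a : Fin d → ℤ) j : ℚ) := by
        simp [combination]
      rw [e, this]
      have h1 := hz j
      have h2 := hx j
      linarith
    · refine hz0 j ?_
      rcases hj with hj | ⟨b, hb, hj⟩
      · exact Or.inl (hx0 j (Or.inl hj))
      · rcases List.mem_append.1 hb with hb | hb
        · exact Or.inr ⟨b, hb, hj⟩
        · obtain rfl := List.mem_singleton.1 hb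
          exact Or.inl (hx0 j (Or.inr hj))

/-- A word can be fired without loss of support if the coordinates that its letters change are
large. -/
theorem exists_pass (f : S → ℚ) (U : List S) {u : List S} (hu : u ⊆ U)
    (hf : ∀ a ∈ u, 0 < f a ∧ f a ≤ 1) {x : Config d}
    (hx : ∀ j, (∃ a ∈ U, (a : Fin d → ℤ) j ≠ 0) →
      (u.map fun a => f a * |((a : Fin d → ℤ) j : ℚ)|).sum < x j) :
    ∃ z, FlaggedRun x (flag (true, false) u) z ∧ ∀ j, (z j : ℚ) = x j + combination f u j := by
  induction u generalizing x with
  | nil => exact ⟨x, rfl, by simp [combination]⟩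
  | cons a u ih =>
    have ha := hf a (by simp)
    have hrest : ∀ j, 0 ≤ (u.map fun a => f a * |((a : Fin d → ℤ) j : ℚ)|).sum := by
      refine fun j => List.sum_nonneg fun q hq => ?_
      obtain ⟨b, hb, rfl⟩ := List.mem_map.1 hq
      exact mul_nonneg (hf b (by simp [hb])).1.le (abs_nonneg _)
    have hbig : ∀ j, (∃ a ∈ U, (a : Fin d → ℤ) j ≠ 0) →
        (u.map fun a => f a * |((a : Fin d → ℤ) j : ℚ)|).sum <
          x j + f a * ((a : Fin d → ℤ) j : ℚ) := by
      intro j hj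
      have h1 := hx j hj
      rw [List.map_cons, List.sum_cons] at h1
      have h2 := mul_le_mul_of_nonneg_left (neg_abs_le ((a : Fin d → ℤ) j : ℚ)) ha.1.le
      linarith
    have htouch : ∀ j, (a : Fin d → ℤ) j ≠ 0 → ∃ a ∈ U, (a : Fin d → ℤ) j ≠ 0 :=
      fun j hj => ⟨a, hu (by simp), hj⟩
    have hnn : ∀ j, 0 ≤ (x j : ℚ) + f a * ((a : Fin d → ℤ) j : ℚ) := by
      intro j
      by_cases hj : (a : Fin d → ℤ) j = 0
      · simp [hj]
      · exact (hrest j).trans (hbig j (htouch j hj)).le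
    obtain ⟨z, hr, hz⟩ := ih (fun b hb => hu (by simp [hb])) (fun b hb => hf b (by simp [hb]))
      (x := fun j => ⟨_, hnn j⟩) hbig
    refine ⟨z, ⟨f a, _, ⟨ha.1, ha.2, fun j => rfl⟩, fun _ j hj h0 => ?_, by simp, hr⟩, fun j => ?_⟩
    · have h0 := congrArg (fun q : ℚ≥0 => (q : ℚ)) h0
      change (x j : ℚ) + f a * ((a : Fin d → ℤ) j : ℚ) = 0 at h0
      by_cases hj0 : (a : Fin d → ℤ) j = 0
      · simp [hj0] at h0
        exact hj h0
      · exact ((hrest j).trans_lt (hbig j (htouch j hj0))).ne' h0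
    · rw [hz, combination_cons, ← add_assoc]
      rfl

theorem cyclePow_succ {A : Type} (N : ℕ) (as : List A) :
    cyclePow (N + 1) as = cyclePow N as ++ as := by
  simp [cyclePow, List.replicate_succ', List.flatten_append]

/-- Two configurations that differ by a positive combination of letters, and in which all
coordinates changed by these letters are positive, are connected by firing the letters cyclically
in sufficiently many rounds, close to the line segment between the two configurations. -/
theorem exists_cycle_run {x z : Config d} {as : List S} {μ : S → ℚ} (hμ : ∀ a ∈ as, 0 < μ a)
    (hz : ∀ j, (z j : ℚ) = x j + combination μ as j)
    (h0 : ∀ j, (∃ a ∈ as, (a : Fin d → ℤ) j ≠ 0) → x j ≠ 0 ∧ z j ≠ 0) :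
    ∃ N₀, ∀ N, N₀ ≤ N → FlaggedRun x (flag (true, false) (cyclePow N as)) z := by
  obtain ⟨ε, hε, hs⟩ := exists_small
    (ι := {j : Fin d // ∃ a ∈ as, (a : Fin d → ℤ) j ≠ 0} ⊕ {a : S // a ∈ as})
    (Sum.elim (fun j => min (x j : ℚ) (z j)) fun _ => 1)
    (Sum.elim (fun j => (as.map fun a => μ a * |((a : Fin d → ℤ) j : ℚ)|).sum) fun a => μ a) (by
      rintro (⟨j, hj⟩ | a)
      · exact lt_min (NNRat.cast_pos.2 (pos_iff_ne_zero.2 (h0 j hj).1))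
          (NNRat.cast_pos.2 (pos_iff_ne_zero.2 (h0 j hj).2))
      · exact one_pos)
  obtain ⟨N₀, hN₀⟩ := exists_nat_gt (1 / ε)
  refine ⟨N₀, fun N hN => ?_⟩
  have hNε : 1 / ε < N := hN₀.trans_le (by exact_mod_cast hN)
  have hN0 : (0 : ℚ) < N := (one_div_pos.2 hε).trans hNε
  have hη : 1 / (N : ℚ) ≤ ε := by
    rw [div_le_iff₀ hN0]
    rw [div_lt_iff₀ hε] at hNε
    linarith
  have hη0 : 0 < 1 / (N : ℚ) := one_div_pos.2 hN0
  have hsum : ∀ j : Fin d, 0 ≤ (as.map fun a => μ a * |((a : Fin d → ℤ) j : ℚ)|).sum := by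
    refine fun j => List.sum_nonneg fun q hq => ?_
    obtain ⟨b, hb, rfl⟩ := List.mem_map.1 hq
    exact mul_nonneg (hμ b hb).le (abs_nonneg _)
  have key : ∀ m : ℕ, m ≤ N → ∃ c : Config d,
      FlaggedRun x (flag (true, false) (cyclePow m as)) c ∧
      ∀ j, (c j : ℚ) = x j + m / N * combination μ as j := by
    intro m
    induction m with
    | zero => exact fun _ => ⟨x, rfl, by simp⟩
    | succ m ih =>
      intro hm
      obtain ⟨c, hr, hc⟩ := ih (by omega)
      have hm1 : (m : ℚ) / N ≤ 1 := by
        rw [div_le_one hN0]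
        exact_mod_cast (by omega : m ≤ N)
      have hm0 : 0 ≤ (m : ℚ) / N := by positivity
      obtain ⟨c', hr', hc'⟩ := exists_pass (fun a => 1 / N * μ a) as (List.Subset.refl as)
        (fun a ha => ⟨mul_pos hη0 (hμ a ha), by
          have h1 := hs (Sum.inr ⟨a, ha⟩)
          simp only [Sum.elim_inr] at h1
          have h2 := mul_le_mul_of_nonneg_right hη (hμ a ha).le
          linarith⟩) (x := c) (fun j hj => by
          have h1 := hs (Sum.inl ⟨j, hj⟩)
          simp only [Sum.elim_inl] at h1
          have h2 := mul_le_mul_of_nonneg_right hη (hsum j)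
          have h3 : (as.map fun a => 1 / (N : ℚ) * μ a * |((a : Fin d → ℤ) j : ℚ)|).sum =
              1 / N * (as.map fun a => μ a * |((a : Fin d → ℤ) j : ℚ)|).sum := by
            rw [← List.sum_map_mul_left]
            simp only [mul_assoc]
          -- `c` lies on the segment between `x` and `z`
          have h4 : min (x j : ℚ) (z j) ≤ c j := by
            have e : (c j : ℚ) = (1 - m / N) * x j + m / N * z j := by
              rw [hc, hz]
              ring
            have h5 := mul_le_mul_of_nonneg_left (min_le_left (x j : ℚ) (z j)) (sub_nonneg.2 hm1)
            have h6 := mul_le_mul_of_nonneg_left (min_le_right (x j : ℚ) (z j)) hm0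
            linarith
          rw [h3]
          linarith)
      refine ⟨c', ?_, fun j => ?_⟩
      · rw [cyclePow_succ, flag, List.map_append]
        exact flaggedRun_append.2 ⟨c, hr, hr'⟩
      · have : combination (fun a => 1 / (N : ℚ) * μ a) as j = 1 / N * combination μ as j := by
          simp only [combination, ← List.sum_map_mul_left, mul_assoc]
        rw [hc', hc, this]
        push_cast
        ring
  obtain ⟨c, hr, hc⟩ := key N le_rfl
  have : c = z := by
    ext j
    rw [hc, hz, div_self hN0.ne', one_mul]
  rwa [← this]

theorem split_of_mem_lowerPart {A : Type} {u₁ u₂ w : List A} {a : A}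
    (h : w ∈ tailLanguage (lowerPart (u₁ ++ a :: u₂))) :
    ∃ w₁ w₂, w = w₁ ++ a :: w₂ ∧ w₁ ⊆ u₁ := by
  have key : ∀ (u pre : List A) (w : List A), w ∈ tailLanguage (lowerFrom pre (u ++ a :: u₂)) →
      ∃ w₁ w₂, w = w₁ ++ a :: w₂ ∧ w₁ ⊆ pre ++ u := by
    intro u
    induction u with
    | nil =>
      intro pre w h
      obtain ⟨s, t, hs, -, rfl⟩ := mem_tailLanguage_cons_star.1 h
      exact ⟨s, t, by simp, fun b hb => by simp [hs b hb]⟩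
    | cons c u ih =>
      intro pre w h
      obtain ⟨s, t, hs, ht, rfl⟩ := mem_tailLanguage_cons_star.1 h
      obtain ⟨w₁, w₂, rfl, hw⟩ := ih _ _ ht
      refine ⟨s ++ [c] ++ w₁, w₂, by simp, fun b hb => ?_⟩
      simp only [List.append_assoc, List.cons_append, List.nil_append, List.mem_append,
        List.mem_cons] at hb ⊢
      rcases hb with hb | hb | hb
      · exact Or.inl (hs b hb)
      · exact Or.inr (Or.inl hb)
      · simpa using hw hb
  rw [lowerPart_eq] at h
  simpa using key u₁ [] w h

theorem split_of_mem_upperPart {A : Type} {u₁ u₂ w : List A} {a : A}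
    (h : w ∈ tailLanguage (upperPart (u₁ ++ a :: u₂))) :
    ∃ w₁ w₂, w = w₁ ++ a :: w₂ ∧ w₂ ⊆ u₂ := by
  have hsub : ∀ (u : List A) (w : List A), w ∈ tailLanguage (upperPart u) → w ⊆ u := by
    intro u
    induction u with
    | nil =>
      rintro w rfl
      simp
    | cons c u ih =>
      intro w h
      obtain ⟨s, t, hs, ht, rfl⟩ := mem_tailLanguage_cons_star.1 h
      obtain ⟨s', t', hs', ht', rfl⟩ := mem_tailLanguage_cons_star.1 ht
      intro b hb
      simp only [List.mem_append, List.mem_cons, List.not_mem_nil, or_false] at hb ⊢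
      rcases hb with (hb | hb) | hb | hb
      · exact absurd (hs b hb) (by simp)
      · exact Or.inl hb
      · exact Or.inr (hs' b hb)
      · exact Or.inr (ih t' ht' hb)
  induction u₁ generalizing w with
  | nil =>
    obtain ⟨s, t, hs, ht, rfl⟩ := mem_tailLanguage_cons_star.1 h
    obtain ⟨s', t', hs', ht', rfl⟩ := mem_tailLanguage_cons_star.1 ht
    refine ⟨s, s' ++ [] ++ t', by simp, fun b hb => ?_⟩
    simp only [List.append_nil, List.mem_append] at hb
    rcases hb with hb | hb
    exacts [hs' b hb, hsub _ _ ht' hb]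
  | cons c u ih =>
    obtain ⟨s, t, hs, ht, rfl⟩ := mem_tailLanguage_cons_star.1 h
    obtain ⟨s', t', hs', ht', rfl⟩ := mem_tailLanguage_cons_star.1 ht
    obtain ⟨w₁, w₂, rfl, hw⟩ := ih ht'
    exact ⟨s ++ [c] ++ (s' ++ [] ++ w₁), w₂, by simp, hw⟩

theorem subset_of_mem_gatheringLanguage {A : Type} {as bs w : List A} (hp : as.Perm bs)
    (h : w ∈ gatheringLanguage as bs) : w ⊆ as ∧ as ⊆ w := by
  obtain ⟨f, g, hf, hg, rfl⟩ := h
  constructor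
  · intro a ha
    simp only [List.mem_append, List.mem_flatten, List.mem_ofFn] at ha
    rcases ha with ⟨_, ⟨i, rfl⟩, ha⟩ | ⟨_, ⟨i, rfl⟩, ha⟩
    · rcases List.mem_cons.1 ha with rfl | ha
      · exact List.get_mem _ _
      · exact List.mem_of_mem_take (hf i a ha)
    · rcases List.mem_cons.1 ha with rfl | ha
      · exact hp.mem_iff.2 (List.get_mem _ _)
      · exact (hg i a ha).1
  · intro a ha
    obtain ⟨i, rfl⟩ := List.get_of_mem ha
    exact List.mem_append_left _ (List.mem_flatten.2 ⟨_, List.mem_ofFn.2 ⟨i, rfl⟩, by simp⟩)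

/-- The sum of the fractions with which the letter `a` is fired. -/
def total [DecidableEq S] (r : List (ℚ × S)) (a : S) : ℚ :=
  (r.map fun e => if e.2 = a then e.1 else 0).sum

theorem effect_eq_combination [DecidableEq S] {as : List S} (hn : as.Nodup) {r : List (ℚ × S)}
    (hr : r.map Prod.snd ⊆ as) (j : Fin d) : effect r j = combination (total r) as j := by
  induction r with
  | nil => simp [combination, total]
  | cons e r ih =>
    rw [effect_cons, ih fun a ha => hr (by simp at ha ⊢; tauto)]
    have he : e.2 ∈ as := hr (by simp)
    simp only [combination, ← List.sum_toFinset _ hn]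
    have : ∀ a : S, total (e :: r) a = (if e.2 = a then e.1 else 0) + total r a := by
      simp [total]
    simp only [this, add_mul, Finset.sum_add_distrib, ite_mul, zero_mul]
    rw [Finset.sum_ite_eq]
    simp [he]

theorem total_pos [DecidableEq S] {r : List (ℚ × S)} (hf : Fractions r) {a : S}
    (ha : a ∈ r.map Prod.snd) : 0 < total r a := by
  obtain ⟨e, he, rfl⟩ := List.mem_map.1 ha
  have h1 : ∀ q ∈ r.map (fun e' => if e'.2 = e.2 then e'.1 else 0), 0 ≤ q := by
    intro q hq
    obtain ⟨e', he', rfl⟩ := List.mem_map.1 hq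
    split_ifs
    exacts [(hf e' he').1.le, le_rfl]
  refine (hf e he).1.trans_le (List.single_le_sum h1 _ (List.mem_map.2 ⟨e, he, by simp⟩))

/-- If some word of a gathering labels a run from `x` to `y`, then for all large `N` the word
`a₁ … aₙ (a₁ … aₙ)ᴺ b₁ … bₙ` labels a run which first does not shrink and then does not enlarge the
support. -/
theorem exists_gathering_run {x y : Config d} {as bs w : List S} (hn : as.Nodup)
    (hp : as.Perm bs) (hw : w ∈ gatheringLanguage as bs) (h : w ∈ transitionLanguage S x y) :
    ∃ N₀, ∀ N, N₀ ≤ N →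
      FlaggedRun x (flag (true, false) (as ++ cyclePow N as) ++ flag (false, true) bs) y := by
  classical
  obtain ⟨r, rfl, hr⟩ := mem_transitionLanguage.1 h
  obtain ⟨hf, hpre, hy⟩ := run_iff.1 hr
  obtain ⟨hsub, hsup⟩ := subset_of_mem_gatheringLanguage hp hw
  rw [gatheringLanguage_eq hn hp] at hw
  obtain ⟨_, ⟨w₁, hw₁, w₂, -, rfl⟩, w₃, hw₃, hw⟩ := hw
  simp only at hw
  have hup : ∀ (u₁ : List S) (a : S) (u₂ : List S), as = u₁ ++ a :: u₂ →
      ∀ j, (a : Fin d → ℤ) j < 0 →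
      x j ≠ 0 ∨ ∃ b ∈ u₁, 0 < (b : Fin d → ℤ) j := by
    rintro u₁ a u₂ rfl j hj
    by_contra hcon
    push Not at hcon
    obtain ⟨v₁, v₂, rfl, hv⟩ := split_of_mem_lowerPart hw₁
    obtain ⟨r₁, r', rfl, hr₁, hr'⟩ := List.map_eq_append_iff.1
      (hw.symm.trans (by simp : _ = v₁ ++ (a :: v₂ ++ w₂ ++ w₃)))
    obtain ⟨e, r₂, rfl, rfl, -⟩ := List.map_eq_cons_iff.1 hr'
    have h1 := hpre (r₁ ++ [e]) r₂ (by simp) j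
    have h2 : effect r₁ j ≤ 0 := by
      refine (List.sum_le_card_nsmul _ 0 fun q hq => ?_).trans_eq (by simp)
      obtain ⟨e', he', rfl⟩ := List.mem_map.1 hq
      refine mul_nonpos_of_nonneg_of_nonpos (hf e' (by simp [he'])).1.le ?_
      have := hcon.2 e'.2 (hv (hr₁ ▸ List.mem_map_of_mem he'))
      exact_mod_cast this
    have h3 : e.1 * ((e.2 : Fin d → ℤ) j : ℚ) < 0 :=
      mul_neg_of_pos_of_neg (hf e (by simp)).1 (by exact_mod_cast hj)
    simp only [hcon.1, NNRat.cast_zero, effect_append, effect_cons, effect_nil] at h1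
    linarith
  have hdown : ∀ (u₁ : List S) (a : S) (u₂ : List S), bs = u₁ ++ a :: u₂ →
      ∀ j, 0 < (a : Fin d → ℤ) j →
      y j ≠ 0 ∨ ∃ b ∈ u₂, (b : Fin d → ℤ) j < 0 := by
    rintro u₁ a u₂ rfl j hj
    by_contra hcon
    push Not at hcon
    obtain ⟨v₁, v₂, rfl, hv⟩ := split_of_mem_upperPart hw₃
    obtain ⟨r₁, r', rfl, -, hr'⟩ := List.map_eq_append_iff.1
      (hw.symm.trans (by simp : _ = (w₁ ++ w₂ ++ v₁) ++ (a :: v₂)))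
    obtain ⟨e, r₂, rfl, rfl, hr₂⟩ := List.map_eq_cons_iff.1 hr'
    have h1 := hpre r₁ (e :: r₂) rfl j
    have h2 : 0 ≤ effect r₂ j := by
      refine List.sum_nonneg fun q hq => ?_
      obtain ⟨e', he', rfl⟩ := List.mem_map.1 hq
      refine mul_nonneg (hf e' (by simp [he'])).1.le ?_
      have := hcon.2 e'.2 (hv (hr₂ ▸ List.mem_map_of_mem he'))
      exact_mod_cast this
    have h3 : 0 < e.1 * ((e.2 : Fin d → ℤ) j : ℚ) :=
      mul_pos (hf e (by simp)).1 (by exact_mod_cast hj)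
    have h4 := hy j
    simp only [hcon.1, NNRat.cast_zero, effect_append, effect_cons] at h4
    linarith
  -- The two tiny runs may together use up only a part of the total fraction of each letter.
  obtain ⟨ε, hε, hs⟩ := exists_small (ι := Option {a : S // a ∈ as})
    (fun o => o.elim 1 fun a => total r a) (fun o => o.elim 1 fun _ => 2) (by
      rintro (_ | ⟨a, ha⟩)
      · exact one_pos
      · exact total_pos hf (hsup ha))
  have hε1 : ε ≤ 1 := by
    have := hs none
    simp only [Option.elim, mul_one] at this
    exact this.le
  obtain ⟨f, p, hfa, hrp, hpx, hp0⟩ := exists_up_run hn hup hε hε1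
  obtain ⟨g, q, hga, hrq, hqy, hq0⟩ := exists_down_run (hp.nodup_iff.1 hn) hdown hε hε1
  obtain ⟨N₀, hN₀⟩ := exists_cycle_run (x := p) (z := q) (as := as)
    (μ := fun a => total r a - f a - g a) (fun a ha => by
      have h1 := hs (some ⟨a, ha⟩)
      simp only [Option.elim] at h1
      have h2 := (hfa a ha).2
      have h3 := (hga a (hp.mem_iff.1 ha)).2
      linarith) (fun j => by
      have h1 : combination g bs j = combination g as j := (hp.map _).sum_eq.symm
      have h2 : combination (fun a => total r a - f a - g a) as j =
          combination (total r) as j - combination f as j - combination g as j := by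
        simp only [combination, sub_mul]
        simp only [← List.sum_toFinset _ hn, Finset.sum_sub_distrib]
      have h3 := hy j
      rw [effect_eq_combination hn hsub] at h3
      have h4 := hqy j
      have h5 := hpx j
      linarith) (fun j hj => ⟨hp0 j (Or.inr hj), hq0 j (Or.inr (by
        obtain ⟨a, ha, hj⟩ := hj
        exact ⟨a, hp.mem_iff.1 ha, hj⟩))⟩)
  refine ⟨N₀, fun N hN => ?_⟩
  rw [flag, List.map_append]
  exact flaggedRun_append.2 ⟨q, flaggedRun_append.2 ⟨p, hrp, hN₀ N hN⟩, hrq⟩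

theorem transitionLanguage_split {x y : Config d} {u v : List S}
    (h : u ++ v ∈ transitionLanguage S x y) :
    ∃ z, u ∈ transitionLanguage S x z ∧ v ∈ transitionLanguage S z y := by
  simp only [← flaggedRun_plain, flag, List.map_append] at h ⊢
  exact flaggedRun_append.1 h

/-- A run of some word of the path-scheme yields the run that the algorithm searches for: the
configurations at both ends of each gathering are kept, and `exists_gathering_run` is applied
between them. -/
theorem exists_flagTail_run {x y : Config d} {l : List (GatheringEntry S)}
    (hl : ∀ g ∈ l, g.1.1.Nodup ∧ g.1.1.Perm g.1.2) {w : List S}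
    (hw : w ∈ tailLanguage (l.map GatheringEntry.toRaw)) (h : w ∈ transitionLanguage S x y) :
    ∃ N₀, ∀ N, N₀ ≤ N → FlaggedRun x (flagTail N l) y := by
  induction l generalizing x w with
  | nil =>
    obtain rfl : w = [] := hw
    exact ⟨0, fun _ _ => flaggedRun_plain.2 h⟩
  | cons g l ih =>
    rw [List.map_cons, tailLanguage_cons] at hw
    obtain ⟨_, ⟨w₁, hw₁, _, rfl, rfl⟩, w₂, hw₂, rfl⟩ := hw
    obtain ⟨q, h, h₂⟩ := transitionLanguage_split h
    obtain ⟨p, h₁, hu⟩ := transitionLanguage_split h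
    obtain ⟨N₁, hN₁⟩ := exists_gathering_run (hl g (by simp)).1 (hl g (by simp)).2 hw₁ h₁
    obtain ⟨N₂, hN₂⟩ := ih (fun g hg => hl g (by simp [hg])) hw₂ h₂
    refine ⟨max N₁ N₂, fun N hN => ?_⟩
    rw [flagTail, List.flatMap_cons]
    exact flaggedRun_append.2 ⟨q, flaggedRun_append.2 ⟨p, hN₁ N (le_of_max_le_left hN),
      flaggedRun_plain.2 hu⟩, hN₂ N (le_of_max_le_right hN)⟩

end Existence

/-! ### The algorithm and its computability -/

/-- What the search looks for: a number of rounds `N`, a common denominator `D`, and a run of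
the word of `flagWord N`, given by its configurations and its fractions, all multiplied by `D`. -/
abbrev Certificate : Type := ℕ × ℕ × List (List ℕ) × List ℕ

/-- The coordinate `j` of the `k`-th configuration, `0` if there is none. -/
def coordAt (zs : List (List ℕ)) (k j : ℕ) : ℕ := (zs.getD k []).getD j 0

/-- The `k`-th step of the certificate fires the letter `e` and respects its flags. To avoid
subtraction, the effect of the letter is split into its positive and its negative part. -/
def StepCheck (d D : ℕ) (zs : List (List ℕ)) (ps : List ℕ) (e : Flagged LetterCode) (k : ℕ) :
    Prop :=
  0 < ps.getD k 0 ∧ ps.getD k 0 ≤ D ∧ ∀ j < d,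
    coordAt zs (k + 1) j + ps.getD k 0 * (-(e.2.getD j 0)).toNat =
      coordAt zs k j + ps.getD k 0 * (e.2.getD j 0).toNat ∧
    (e.1.1 = true → coordAt zs k j ≠ 0 → coordAt zs (k + 1) j ≠ 0) ∧
    (e.1.2 = true → coordAt zs (k + 1) j ≠ 0 → coordAt zs k j ≠ 0)

/-- The `k`-th configuration of the certificate is `D` times the configuration with code `x`. -/
def EndCheck (d D : ℕ) (x : ConfigCode) (zs : List (List ℕ)) (k : ℕ) : Prop :=
  ∀ j < d, coordAt zs k j * (x.getD j (0, 0)).2 = (x.getD j (0, 0)).1 * D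

/-- Reads a path-scheme all of whose bubbles are gatherings. The value on stars is irrelevant. -/
def readTail (t : RawTail LetterCode) : List (GatheringEntry LetterCode) :=
  t.map fun p => (Sum.elim (fun B => (B, B)) id p.1, p.2)

/-- The word for which the certificate has to contain a run. -/
def flagWord {A : Type} (N : ℕ) (u : List A) (l : List (GatheringEntry A)) : List (Flagged A) :=
  flag (false, false) u ++ flagTail N l

/-- The word for which a certificate with `N` rounds for the input `c` has to contain a run. -/
def inputWord (c : InputCode) (N : ℕ) : List (Flagged LetterCode) :=
  flagWord N c.2.2.2.2.1 (readTail c.2.2.2.2.2)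

/-- `q` is a valid certificate for the input `c`. -/
def Check (c : InputCode) (q : Certificate) : Prop :=
  0 < q.2.1 ∧ EndCheck c.1 q.2.1 c.2.2.1 q.2.2.1 0 ∧
    EndCheck c.1 q.2.1 c.2.2.2.1 q.2.2.1 (inputWord c q.1).length ∧
    ∀ k < (inputWord c q.1).length,
      StepCheck c.1 q.2.1 q.2.2.1 q.2.2.2 ((inputWord c q.1).getD k default) k

/-- The decomposition that belongs to the number of rounds `N`. -/
def output (c : InputCode) (N : ℕ) : SchemeCode × List SchemeCode :=
  ((c.2.2.2.2.1, richTail N (readTail c.2.2.2.2.2)),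
    (poorTails N (readTail c.2.2.2.2.2)).map fun t => (c.2.2.2.2.1, t))

open Classical in
/-- The candidate with number `n` is decoded and checked. -/
noncomputable def attempt (c : InputCode) (n : ℕ) : Option (SchemeCode × List SchemeCode) :=
  (Encodable.decode (α := Certificate) n).bind fun q =>
    if Check c q then some (output c q.1) else none

/-- The algorithm: search for a valid certificate and output the decomposition that belongs to its
number of rounds. -/
noncomputable def decompose (c : InputCode) : Part (SchemeCode × List SchemeCode) :=
  Nat.rfindOpt (attempt c)

section Primrec

open Primrec

variable {A B : Type} [Primcodable A] [Primcodable B]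

theorem primrec_toNat : Primrec Int.toNat := by
  have h : Primrec fun z : ℤ => if Encodable.encode z % 2 = 0 then Encodable.encode z / 2 else 0 :=
    Primrec.ite (Primrec.eq.comp (nat_mod.comp Primrec.encode (const 2)) (const 0))
      (nat_div.comp Primrec.encode (const 2)) (const 0)
  refine h.of_eq fun z => ?_
  cases z with
  | ofNat n =>
    have : Encodable.encode (Int.ofNat n) = 2 * n := rfl
    rw [this]
    simp
  | negSucc n =>
    have : Encodable.encode (Int.negSucc n) = 2 * n + 1 := rfl
    rw [this]
    simp

theorem primrec_neg_toNat : Primrec fun z : ℤ => (-z).toNat := by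
  have h : Primrec fun z : ℤ =>
      if Encodable.encode z % 2 = 0 then 0 else Encodable.encode z / 2 + 1 :=
    Primrec.ite (Primrec.eq.comp (nat_mod.comp Primrec.encode (const 2)) (const 0)) (const 0)
      (Primrec.succ.comp (nat_div.comp Primrec.encode (const 2)))
  refine h.of_eq fun z => ?_
  cases z with
  | ofNat n =>
    have : Encodable.encode (Int.ofNat n) = 2 * n := rfl
    rw [this]
    simp
  | negSucc n =>
    have : Encodable.encode (Int.negSucc n) = 2 * n + 1 := rfl
    rw [this]
    simp
    omega

theorem primrec_flag (m : Bool × Bool) : Primrec (flag m : List A → List (Flagged A)) :=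
  list_map Primrec.id (Primrec₂.pair.comp₂ (Primrec₂.const m) Primrec₂.right)

theorem primrec_cyclePow : Primrec₂ (cyclePow : ℕ → List A → List A) := by
  have h : Primrec₂ fun (N : ℕ) (as : List A) => (List.range N).flatMap fun _ => as :=
    list_flatMap (list_range.comp fst) (snd.comp fst)
  exact h.of_eq fun N as => by simp [cyclePow, List.flatMap, List.map_const']

theorem primrec_lowerPart : Primrec (lowerPart : List A → RawTail A) := by
  refine snd.comp (list_foldl Primrec.id (const ([], [])) (h := fun _ p => lowerStep p.1 p.2) ?_)
  have h1 : Primrec fun p : List A × ((List A × RawTail A) × A) => p.2.1.1 :=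
    fst.comp (fst.comp snd)
  have h2 : Primrec fun p : List A × ((List A × RawTail A) × A) => p.2.1.2 :=
    snd.comp (fst.comp snd)
  have h3 : Primrec fun p : List A × ((List A × RawTail A) × A) => p.2.2 := snd.comp snd
  exact Primrec.pair (list_concat.comp h1 h3) (list_concat.comp h2
    (Primrec.pair (sumInl.comp h1) (list_cons.comp h3 (const []))))

theorem primrec_upperPart : Primrec (upperPart : List A → RawTail A) := by
  have h : Primrec fun l : List A => (List.recOn l [] fun b l ih =>
      (Sum.inl [], [b]) :: (Sum.inl l, []) :: ih : RawTail A) := by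
    refine list_rec Primrec.id (const [])
      (h := fun _ p => (Sum.inl [], [p.1]) :: (Sum.inl p.2.1, []) :: p.2.2) ?_
    have h1 : Primrec fun p : List A × (A × List A × RawTail A) => p.2.1 := fst.comp snd
    have h2 : Primrec fun p : List A × (A × List A × RawTail A) => p.2.2.1 :=
      fst.comp (snd.comp snd)
    have h3 : Primrec fun p : List A × (A × List A × RawTail A) => p.2.2.2 :=
      snd.comp (snd.comp snd)
    exact list_cons.comp (Primrec.pair (const _) (list_cons.comp h1 (const [])))
      (list_cons.comp (Primrec.pair (sumInl.comp h2) (const [])) h3)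
  refine h.of_eq fun l => ?_
  induction l with
  | nil => rfl
  | cons b l ih => simp only [upperPart, ← ih]

theorem primrec_unfold :
    Primrec₂ (GatheringEntry.unfold : GatheringEntry A → RawTail A → RawTail A) := by
  have h1 : Primrec fun p : GatheringEntry A × RawTail A => p.1.1.1 := fst.comp (fst.comp fst)
  have h2 : Primrec fun p : GatheringEntry A × RawTail A => p.1.1.2 := snd.comp (fst.comp fst)
  have h3 : Primrec fun p : GatheringEntry A × RawTail A => p.1.2 := snd.comp fst
  exact list_append.comp (list_append.comp (list_append.comp (primrec_lowerPart.comp h1) snd)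
    (primrec_upperPart.comp h2))
    (list_cons.comp (Primrec.pair (const (Sum.inl [])) h3) (const []))

theorem primrec_richMiddle : Primrec₂ (richMiddle : List A → List A → RawTail A) := by
  have h : Primrec fun q : (List A × List A) × A =>
      ((Sum.inl q.1.1, [q.2]) : RawBubble A × List A) :=
    Primrec.pair (sumInl.comp (fst.comp fst)) (list_cons.comp snd (const []))
  exact list_append.comp (list_map snd h)
    (list_cons.comp (Primrec.pair (sumInl.comp fst) (const [])) (const []))

theorem primrec_toRaw :
    Primrec (GatheringEntry.toRaw : GatheringEntry A → RawBubble A × List A) :=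
  Primrec.pair (sumInr.comp fst) snd

theorem primrec_flagTail :
    Primrec₂ (flagTail : ℕ → List (GatheringEntry A) → List (Flagged A)) := by
  refine list_flatMap snd ?_
  have hN : Primrec fun p : (ℕ × List (GatheringEntry A)) × GatheringEntry A => p.1.1 :=
    fst.comp fst
  have h1 : Primrec fun p : (ℕ × List (GatheringEntry A)) × GatheringEntry A => p.2.1.1 :=
    fst.comp (fst.comp snd)
  have h2 : Primrec fun p : (ℕ × List (GatheringEntry A)) × GatheringEntry A => p.2.1.2 :=
    snd.comp (fst.comp snd)
  have h3 : Primrec fun p : (ℕ × List (GatheringEntry A)) × GatheringEntry A => p.2.2 :=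
    snd.comp snd
  exact list_append.comp (list_append.comp
    ((primrec_flag _).comp (list_append.comp h1 (primrec_cyclePow.comp hN h1)))
    ((primrec_flag _).comp h2)) ((primrec_flag _).comp h3)

theorem primrec_richTail :
    Primrec₂ (richTail : ℕ → List (GatheringEntry A) → RawTail A) := by
  refine list_flatMap snd ?_
  have hN : Primrec fun p : (ℕ × List (GatheringEntry A)) × GatheringEntry A => p.1.1 :=
    fst.comp fst
  have h1 : Primrec fun p : (ℕ × List (GatheringEntry A)) × GatheringEntry A => p.2.1.1 :=
    fst.comp (fst.comp snd)
  exact primrec_unfold.comp snd (primrec_richMiddle.comp h1 (primrec_cyclePow.comp hN h1))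

theorem primrec_erase [DecidableEq A] : Primrec₂ fun (as : List A) (c : A) =>
    as.filter fun a => a ≠ c :=
  PrimrecRel.listFilter (R := fun a c : A => a ≠ c) Primrec.eq.not

theorem primrec_poorMiddles [DecidableEq A] :
    Primrec₂ (poorMiddles : List A → List A → List (RawTail A)) := by
  have h : Primrec₂ fun (as z : List A) => (List.recOn z [] fun c _ ih =>
      [(Sum.inl (as.filter fun a => a ≠ c), [])] ::
        ih.map fun m => (Sum.inl (as.filter fun a => a ≠ c), [c]) :: m : List (RawTail A)) := by
    refine list_rec snd (const [])
      (h := fun (p : List A × List A) (q : A × List A × List (RawTail A)) =>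
        [(Sum.inl (p.1.filter fun a => a ≠ q.1), [])] ::
        q.2.2.map fun m => (Sum.inl (p.1.filter fun a => a ≠ q.1), [q.1]) :: m) ?_
    have hc : Primrec fun r : (List A × List A) × (A × List A × List (RawTail A)) => r.2.1 :=
      fst.comp snd
    have hi : Primrec fun r : (List A × List A) × (A × List A × List (RawTail A)) => r.2.2.2 :=
      snd.comp (snd.comp snd)
    have he : Primrec fun r : (List A × List A) × (A × List A × List (RawTail A)) =>
        (Sum.inl (r.1.1.filter fun a => a ≠ r.2.1) : RawBubble A) :=
      sumInl.comp (primrec_erase.comp (fst.comp fst) hc)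
    refine list_cons.comp (list_cons.comp (Primrec.pair he (const [])) (const []))
      (list_map hi ?_)
    exact list_cons.comp (Primrec.pair (he.comp fst)
      (list_cons.comp (hc.comp fst) (const []))) snd
  refine h.of_eq fun as z => ?_
  induction z with
  | nil => rfl
  | cons c z ih => simp only [poorMiddles, ← ih]

theorem primrec_poorTails [DecidableEq A] :
    Primrec₂ (poorTails : ℕ → List (GatheringEntry A) → List (RawTail A)) := by
  have h : Primrec₂ fun (N : ℕ) (l : List (GatheringEntry A)) => (List.recOn l [] fun g l ih =>
      (poorMiddles g.1.1 (cyclePow N g.1.1)).map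
        (fun m => g.unfold m ++ l.map GatheringEntry.toRaw) ++ ih.map (fun t => g.toRaw :: t) :
      List (RawTail A)) := by
    refine list_rec snd (const [])
      (h := fun (p : ℕ × List (GatheringEntry A))
        (q : GatheringEntry A × List (GatheringEntry A) × List (RawTail A)) =>
        (poorMiddles q.1.1.1 (cyclePow p.1 q.1.1.1)).map
          (fun m => q.1.unfold m ++ q.2.1.map GatheringEntry.toRaw) ++
          q.2.2.map (fun t => q.1.toRaw :: t)) ?_
    have hN : Primrec fun r : (ℕ × List (GatheringEntry A)) ×
        (GatheringEntry A × List (GatheringEntry A) × List (RawTail A)) => r.1.1 := fst.comp fst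
    have hg : Primrec fun r : (ℕ × List (GatheringEntry A)) ×
        (GatheringEntry A × List (GatheringEntry A) × List (RawTail A)) => r.2.1 := fst.comp snd
    have hl : Primrec fun r : (ℕ × List (GatheringEntry A)) ×
        (GatheringEntry A × List (GatheringEntry A) × List (RawTail A)) => r.2.2.1 :=
      fst.comp (snd.comp snd)
    have hi : Primrec fun r : (ℕ × List (GatheringEntry A)) ×
        (GatheringEntry A × List (GatheringEntry A) × List (RawTail A)) => r.2.2.2 :=
      snd.comp (snd.comp snd)
    have ha := fst.comp (fst.comp hg)
    refine list_append.comp (list_map (primrec_poorMiddles.comp ha (primrec_cyclePow.comp hN ha))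
      ?_) (list_map hi ?_)
    · exact list_append.comp (primrec_unfold.comp (hg.comp fst) snd)
        (list_map (hl.comp fst) (primrec_toRaw.comp₂ Primrec₂.right))
    · exact list_cons.comp (primrec_toRaw.comp (hg.comp fst)) snd
  refine h.of_eq fun N l => ?_
  induction l with
  | nil => rfl
  | cons g l ih => simp only [poorTails, ← ih]

theorem primrec_readTail : Primrec readTail := by
  refine list_map Primrec.id ?_
  refine Primrec.pair ?_ (snd.comp snd)
  have h : Primrec fun p : RawTail LetterCode × (RawBubble LetterCode × WordCode) =>
      (Sum.casesOn p.2.1 (fun B => (B, B)) id : List LetterCode × List LetterCode) :=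
    sumCasesOn (fst.comp snd) (Primrec.pair snd snd) snd
  refine h.of_eq fun p => ?_
  rcases p.2.1 with B | g <;> rfl

theorem primrec_inputWord : Primrec₂ inputWord := by
  have hs : Primrec fun p : InputCode × ℕ => p.1.2.2.2.2 :=
    snd.comp (snd.comp (snd.comp (snd.comp fst)))
  exact list_append.comp ((primrec_flag _).comp (fst.comp hs))
    (primrec_flagTail.comp snd (primrec_readTail.comp (snd.comp hs)))

theorem primrec_output : Primrec₂ output := by
  have hs : Primrec fun p : InputCode × ℕ => p.1.2.2.2.2 :=
    snd.comp (snd.comp (snd.comp (snd.comp fst)))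
  have hr := primrec_readTail.comp (snd.comp hs)
  refine Primrec.pair (Primrec.pair (fst.comp hs) (primrec_richTail.comp snd hr))
    (list_map (primrec_poorTails.comp snd hr) ?_)
  exact Primrec.pair ((fst.comp hs).comp fst) snd

theorem primrec_coordAt {f : A → List (List ℕ)} {g h : A → ℕ} (hf : Primrec f) (hg : Primrec g)
    (hh : Primrec h) : Primrec fun a => coordAt (f a) (g a) (h a) :=
  (list_getD 0).comp ((list_getD []).comp hf hg) hh

theorem primrecPred_imp {p q : A → Prop} (hp : PrimrecPred p) (hq : PrimrecPred q) :
    PrimrecPred fun a => p a → q a :=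
  (hp.not.or hq).of_eq fun _ => imp_iff_not_or.symm

theorem primrecPred_forall_lt {f : A → ℕ} {p : ℕ → A → Prop} (hf : Primrec f)
    (hp : PrimrecPred fun q : ℕ × A => p q.1 q.2) : PrimrecPred fun a => ∀ j < f a, p j a :=
  ((PrimrecRel.forall_mem_list hp.primrecRel).comp (list_range.comp hf) Primrec.id).of_eq
    fun a => by simp

theorem primrecPred_endCheck {f g k : A → ℕ} {x : A → ConfigCode} {zs : A → List (List ℕ)}
    (hf : Primrec f) (hg : Primrec g) (hx : Primrec x) (hz : Primrec zs) (hk : Primrec k) :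
    PrimrecPred fun a => EndCheck (f a) (g a) (x a) (zs a) (k a) := by
  have hxj : Primrec fun p : ℕ × A => (x p.2).getD p.1 (0, 0) :=
    (list_getD (0, 0)).comp (hx.comp snd) fst
  have h : PrimrecPred fun p : ℕ × A =>
      coordAt (zs p.2) (k p.2) p.1 * ((x p.2).getD p.1 (0, 0)).2 =
        ((x p.2).getD p.1 (0, 0)).1 * g p.2 :=
    Primrec.eq.comp
      (nat_mul.comp (primrec_coordAt (hz.comp snd) (hk.comp snd) fst) (snd.comp hxj))
      (nat_mul.comp (fst.comp hxj) (hg.comp snd))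
  exact primrecPred_forall_lt hf h

theorem primrecPred_stepCheck {f g k : A → ℕ} {zs : A → List (List ℕ)} {ps : A → List ℕ}
    {e : A → Flagged LetterCode} (hf : Primrec f) (hg : Primrec g) (hz : Primrec zs)
    (hp : Primrec ps) (he : Primrec e) (hk : Primrec k) :
    PrimrecPred fun a => StepCheck (f a) (g a) (zs a) (ps a) (e a) (k a) := by
  have hpk : Primrec fun a => (ps a).getD (k a) 0 := (list_getD 0).comp hp hk
  have hej : Primrec fun q : ℕ × A => (e q.2).2.getD q.1 0 :=
    (list_getD 0).comp (snd.comp (he.comp snd)) fst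
  have h0 : Primrec fun q : ℕ × A => coordAt (zs q.2) (k q.2) q.1 :=
    primrec_coordAt (hz.comp snd) (hk.comp snd) fst
  have h1 : Primrec fun q : ℕ × A => coordAt (zs q.2) (k q.2 + 1) q.1 :=
    primrec_coordAt (hz.comp snd) (Primrec.succ.comp (hk.comp snd)) fst
  have n0 : PrimrecPred fun q : ℕ × A => coordAt (zs q.2) (k q.2) q.1 ≠ 0 :=
    (Primrec.eq.comp h0 (const 0)).not
  have n1 : PrimrecPred fun q : ℕ × A => coordAt (zs q.2) (k q.2 + 1) q.1 ≠ 0 :=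
    (Primrec.eq.comp h1 (const 0)).not
  have b1 : PrimrecPred fun q : ℕ × A => (e q.2).1.1 = true :=
    Primrec.eq.comp (fst.comp (fst.comp (he.comp snd))) (const true)
  have b2 : PrimrecPred fun q : ℕ × A => (e q.2).1.2 = true :=
    Primrec.eq.comp (snd.comp (fst.comp (he.comp snd))) (const true)
  have hj : PrimrecPred fun q : ℕ × A =>
      coordAt (zs q.2) (k q.2 + 1) q.1 + (ps q.2).getD (k q.2) 0 *
        (-((e q.2).2.getD q.1 0)).toNat =
      coordAt (zs q.2) (k q.2) q.1 + (ps q.2).getD (k q.2) 0 * ((e q.2).2.getD q.1 0).toNat ∧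
      ((e q.2).1.1 = true → coordAt (zs q.2) (k q.2) q.1 ≠ 0 →
        coordAt (zs q.2) (k q.2 + 1) q.1 ≠ 0) ∧
      ((e q.2).1.2 = true → coordAt (zs q.2) (k q.2 + 1) q.1 ≠ 0 →
        coordAt (zs q.2) (k q.2) q.1 ≠ 0) :=
    (Primrec.eq.comp
      (nat_add.comp h1 (nat_mul.comp (hpk.comp snd) (primrec_neg_toNat.comp hej)))
      (nat_add.comp h0 (nat_mul.comp (hpk.comp snd) (primrec_toNat.comp hej)))).and
      ((primrecPred_imp b1 (primrecPred_imp n0 n1)).and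
        (primrecPred_imp b2 (primrecPred_imp n1 n0)))
  exact (nat_lt.comp (const 0) hpk).and ((nat_le.comp hpk hg).and
    (primrecPred_forall_lt hf hj))

theorem primrecPred_check : PrimrecPred fun p : InputCode × Certificate => Check p.1 p.2 := by
  have hd : Primrec fun p : InputCode × Certificate => p.1.1 := fst.comp fst
  have hx : Primrec fun p : InputCode × Certificate => p.1.2.2.1 :=
    fst.comp (snd.comp (snd.comp fst))
  have hy : Primrec fun p : InputCode × Certificate => p.1.2.2.2.1 :=
    fst.comp (snd.comp (snd.comp (snd.comp fst)))
  have hN : Primrec fun p : InputCode × Certificate => p.2.1 := fst.comp snd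
  have hD : Primrec fun p : InputCode × Certificate => p.2.2.1 := fst.comp (snd.comp snd)
  have hz : Primrec fun p : InputCode × Certificate => p.2.2.2.1 :=
    fst.comp (snd.comp (snd.comp snd))
  have hp : Primrec fun p : InputCode × Certificate => p.2.2.2.2 :=
    snd.comp (snd.comp (snd.comp snd))
  have hw : Primrec fun p : InputCode × Certificate => inputWord p.1 p.2.1 :=
    primrec_inputWord.comp fst hN
  have hstep : PrimrecPred fun p : ℕ × InputCode × Certificate =>
      StepCheck p.2.1.1 p.2.2.2.1 p.2.2.2.2.1 p.2.2.2.2.2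
        ((inputWord p.2.1 p.2.2.1).getD p.1 default) p.1 :=
    primrecPred_stepCheck (hd.comp snd) (hD.comp snd) (hz.comp snd) (hp.comp snd)
      ((list_getD default).comp (hw.comp snd) fst) fst
  exact (nat_lt.comp (const 0) hD).and ((primrecPred_endCheck hd hD hx hz (const 0)).and
    ((primrecPred_endCheck hd hD hy hz (list_length.comp hw)).and
      (primrecPred_forall_lt (list_length.comp hw) hstep)))

theorem primrec_attempt : Primrec₂ attempt := by
  classical
  refine option_bind (Primrec.decode.comp snd) ?_
  refine Primrec.ite (primrecPred_check.comp (Primrec.pair (fst.comp fst) snd)) ?_ (const none)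
  exact option_some.comp (primrec_output.comp (fst.comp fst) (fst.comp snd))

theorem partrec_decompose : Partrec decompose := Partrec.rfindOpt primrec_attempt.to_comp

end Primrec

/-! ### Certificates and runs -/

section Certificates

variable {d : ℕ} {S : Finset (Fin d → ℤ)}

theorem flaggedRun_iff_exists_seq {x y : Config d} {m : List (Flagged S)} :
    FlaggedRun x m y ↔ ∃ (c : ℕ → Config d) (α : ℕ → ℚ), c 0 = x ∧ c m.length = y ∧
      ∀ k (h : k < m.length), Step (c k) (α k) (m[k].2 : Fin d → ℤ) (c (k + 1)) ∧
        (m[k].1.1 = true → ∀ j, c k j ≠ 0 → c (k + 1) j ≠ 0) ∧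
        (m[k].1.2 = true → ∀ j, c (k + 1) j ≠ 0 → c k j ≠ 0) := by
  induction m generalizing x with
  | nil =>
    constructor
    · intro h
      exact ⟨fun _ => x, fun _ => 1, rfl, h, by simp⟩
    · rintro ⟨c, α, h0, h1, -⟩
      exact h0.symm.trans h1
  | cons e m ih =>
    simp only [FlaggedRun, ih]
    constructor
    · rintro ⟨α, z, hz, h1, h2, c, β, rfl, hy, hs⟩
      refine ⟨fun k => k.casesOn x c, fun k => k.casesOn α β, rfl, hy, fun k hk => ?_⟩
      cases k with
      | zero => exact ⟨hz, h1, h2⟩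
      | succ k => exact hs k (by simpa using hk)
    · rintro ⟨c, β, rfl, hy, hs⟩
      obtain ⟨h0, h1, h2⟩ := hs 0 (by simp)
      refine ⟨β 0, c 1, h0, h1, h2, fun k => c (k + 1), fun k => β (k + 1), rfl, hy,
        fun k hk => ?_⟩
      exact hs (k + 1) (by simpa using hk)

theorem getD_letterCode (t : Fin d → ℤ) {j : ℕ} (hj : j < d) :
    (letterCode t).getD j 0 = t ⟨j, hj⟩ := by
  simp [letterCode, List.getD_eq_getElem?_getD, hj]

theorem getD_configCode (x : Config d) {j : ℕ} (hj : j < d) :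
    (configCode x).getD j (0, 0) = ((x ⟨j, hj⟩).num, (x ⟨j, hj⟩).den) := by
  simp [configCode, List.getD_eq_getElem?_getD, hj]

theorem scaled_eq_iff {q : ℚ≥0} {n D : ℕ} (hD : 0 < D) :
    n * q.den = q.num * D ↔ (n : ℚ≥0) / D = q := by
  have hd : (q.den : ℚ≥0) ≠ 0 := by exact_mod_cast q.den_ne_zero
  have hD' : (D : ℚ≥0) ≠ 0 := by exact_mod_cast hD.ne'
  conv_rhs => rw [← NNRat.num_div_den q, div_eq_div_iff hD' hd]
  exact_mod_cast Iff.rfl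

theorem endCheck_iff {x : Config d} {D k : ℕ} (hD : 0 < D) {zs : List (List ℕ)} :
    EndCheck d D (configCode x) zs k ↔
      (fun j : Fin d => (coordAt zs k j : ℚ≥0) / D) = x := by
  rw [funext_iff]
  constructor
  · intro h j
    have := h j j.2
    rw [getD_configCode x j.2] at this
    exact (scaled_eq_iff hD).1 this
  · intro h j hj
    rw [getD_configCode x hj]
    exact (scaled_eq_iff hD).2 (h ⟨j, hj⟩)

theorem split_eq_iff {n n' p : ℕ} {t : ℤ} {D : ℕ} (hD : 0 < D) :
    n' + p * (-t).toNat = n + p * t.toNat ↔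
      ((n' : ℚ) / D = (n : ℚ) / D + (p : ℚ) / D * t) := by
  have hD' : (D : ℚ) ≠ 0 := by exact_mod_cast hD.ne'
  have h1 : (t : ℚ) = t.toNat - (-t).toNat := by
    exact_mod_cast (Int.toNat_sub_toNat_neg t).symm
  rw [h1, div_mul_eq_mul_div, ← add_div, div_left_inj' hD', mul_sub, ← @Nat.cast_inj ℚ]
  push_cast
  constructor <;> intro h <;> linarith

theorem stepCheck_iff {D k : ℕ} (hD : 0 < D) {zs : List (List ℕ)} {ps : List ℕ} {b : Bool × Bool}
    {t : Fin d → ℤ} :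
    StepCheck d D zs ps (b, letterCode t) k ↔
      Step (fun j : Fin d => (coordAt zs k j : ℚ≥0) / D) ((ps.getD k 0 : ℚ) / D) t
          (fun j : Fin d => (coordAt zs (k + 1) j : ℚ≥0) / D) ∧
        (b.1 = true → ∀ j : Fin d, (coordAt zs k j : ℚ≥0) / D ≠ 0 →
          (coordAt zs (k + 1) j : ℚ≥0) / D ≠ 0) ∧
        (b.2 = true → ∀ j : Fin d, (coordAt zs (k + 1) j : ℚ≥0) / D ≠ 0 →
          (coordAt zs k j : ℚ≥0) / D ≠ 0) := by
  have hDQ : (0 : ℚ) < D := by exact_mod_cast hD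
  have e1 : (0 : ℚ) < (ps.getD k 0 : ℚ) / D ↔ 0 < ps.getD k 0 := by
    rw [div_pos_iff_of_pos_right hDQ]
    exact_mod_cast Iff.rfl
  have e2 : (ps.getD k 0 : ℚ) / D ≤ 1 ↔ ps.getD k 0 ≤ D := by
    rw [div_le_one hDQ]
    exact_mod_cast Iff.rfl
  have e3 : ∀ n : ℕ, (n : ℚ≥0) / D ≠ 0 ↔ n ≠ 0 := by
    intro n
    simp [hD.ne']
  simp only [StepCheck, Step, e1, e2, e3, NNRat.cast_div, NNRat.cast_natCast]
  constructor
  · rintro ⟨h1, h2, h3⟩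
    refine ⟨⟨h1, h2, fun j => ?_⟩, fun hb j => (h3 j j.2).2.1 hb, fun hb j => (h3 j j.2).2.2 hb⟩
    have := (h3 j j.2).1
    rw [getD_letterCode t j.2] at this
    exact (split_eq_iff hD).1 this
  · rintro ⟨⟨h1, h2, h3⟩, h4, h5⟩
    refine ⟨h1, h2, fun j hj => ⟨?_, fun hb => h4 hb ⟨j, hj⟩, fun hb => h5 hb ⟨j, hj⟩⟩⟩
    rw [getD_letterCode t hj]
    exact (split_eq_iff hD).2 (h3 ⟨j, hj⟩)

/-- Finitely many non-negative rationals have a common denominator. -/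
theorem exists_common_denominator {ι : Type*} [Fintype ι] (q : ι → ℚ≥0) :
    ∃ D : ℕ, 0 < D ∧ ∀ i, ∃ n : ℕ, (n : ℚ≥0) / D = q i := by
  have hD : 0 < ∏ i, (q i).den := Finset.prod_pos fun i _ => (q i).den_pos
  refine ⟨∏ i, (q i).den, hD, fun i => ?_⟩
  obtain ⟨e, he⟩ := Finset.dvd_prod_of_mem (fun i => (q i).den) (Finset.mem_univ i)
  refine ⟨(q i).num * e, (scaled_eq_iff hD).1 ?_⟩
  rw [he]
  ring

theorem coordAt_eq {n : ℕ → ℕ → ℕ} {K k j : ℕ} (hk : k < K) (hj : j < d) :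
    coordAt ((List.range K).map fun k => (List.range d).map (n k)) k j = n k j := by
  simp [coordAt, List.getD_eq_getElem?_getD, hk, hj]

/-- The checks on the configurations and fractions of a certificate express that it describes a
run, and every run is described by some certificate. -/
theorem flaggedRun_iff_exists_certificate {x y : Config d} {m : List (Flagged S)} :
    FlaggedRun x m y ↔ ∃ (D : ℕ) (zs : List (List ℕ)) (ps : List ℕ), 0 < D ∧
      EndCheck d D (configCode x) zs 0 ∧ EndCheck d D (configCode y) zs m.length ∧
      ∀ k (h : k < m.length), StepCheck d D zs ps (m[k].1, letterCode (m[k].2 : Fin d → ℤ)) k := by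
  rw [flaggedRun_iff_exists_seq]
  constructor
  · rintro ⟨c, α, rfl, rfl, hs⟩
    obtain ⟨D, hD, hn⟩ := exists_common_denominator
      (ι := (Fin (m.length + 1) × Fin d) ⊕ Fin m.length)
      (Sum.elim (fun i => c i.1 i.2) fun k => (α k).toNNRat)
    choose n hn using hn
    have hc : ∀ k < m.length + 1, (fun j : Fin d => (coordAt ((List.range (m.length + 1)).map
        fun k => (List.range d).map fun j => if h : k < m.length + 1 ∧ j < d then
          n (Sum.inl (⟨k, h.1⟩, ⟨j, h.2⟩)) else 0) k j : ℚ≥0) / D) = c k := by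
      intro k hk
      ext1 j
      rw [coordAt_eq hk j.2, dif_pos ⟨hk, j.2⟩]
      exact hn (Sum.inl (⟨k, hk⟩, j))
    refine ⟨D, _, (List.range m.length).map fun k => if h : k < m.length then
      n (Sum.inr ⟨k, h⟩) else 0, hD, (endCheck_iff hD).2 (hc 0 (by omega)),
      (endCheck_iff hD).2 (hc _ (by omega)), fun k hk => (stepCheck_iff hD).2 ?_⟩
    have hp : ((((List.range m.length).map fun k => if h : k < m.length then
        n (Sum.inr ⟨k, h⟩) else 0).getD k 0 : ℕ) : ℚ) / D = α k := by
      have h1 := congrArg (fun q : ℚ≥0 => (q : ℚ)) (hn (Sum.inr ⟨k, hk⟩))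
      simp only [Sum.elim_inr, NNRat.cast_div, NNRat.cast_natCast] at h1
      rw [show ((α k).toNNRat : ℚ) = α k from Rat.coe_toNNRat _ (hs k hk).1.1.le] at h1
      simpa [List.getD_eq_getElem?_getD, hk] using h1
    rw [hp]
    have h0 := hc k (by omega)
    have h1 := hc (k + 1) (by omega)
    rw [h0, h1]
    refine ⟨(hs k hk).1, fun hb j => ?_, fun hb j => ?_⟩
    · rw [congrFun h0 j, congrFun h1 j]
      exact (hs k hk).2.1 hb j
    · rw [congrFun h0 j, congrFun h1 j]
      exact (hs k hk).2.2 hb j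
  · rintro ⟨D, zs, ps, hD, hx, hy, hs⟩
    exact ⟨fun k j => (coordAt zs k j : ℚ≥0) / D, fun k => (ps.getD k 0 : ℚ) / D,
      (endCheck_iff hD).1 hx, (endCheck_iff hD).1 hy, fun k hk => (stepCheck_iff hD).1 (hs k hk)⟩

end Certificates

/-! ### Passing to codes -/

section Codes

variable {A B : Type}

/-- The effect of a map of letters on gathering entries. -/
def GatheringEntry.map (φ : A → B) (g : GatheringEntry A) : GatheringEntry B :=
  ((g.1.1.map φ, g.1.2.map φ), g.2.map φ)

/-- The effect of a map of letters on the entries of path-schemes. -/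
def mapRaw (φ : A → B) (p : RawBubble A × List A) : RawBubble B × List B :=
  (Sum.map (List.map φ) (Prod.map (List.map φ) (List.map φ)) p.1, p.2.map φ)

/-- The effect of a map of letters on flagged letters. -/
def mapFlagged (φ : A → B) (e : Flagged A) : Flagged B := (e.1, φ e.2)

variable (φ : A → B)

theorem cyclePow_map (N : ℕ) (as : List A) : cyclePow N (as.map φ) = (cyclePow N as).map φ := by
  simp [cyclePow, List.map_flatten]

theorem flag_map (b : Bool × Bool) (u : List A) :
    flag b (u.map φ) = (flag b u).map (mapFlagged φ) := by
  simp [flag, mapFlagged]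

theorem flagWord_map (N : ℕ) (u : List A) (l : List (GatheringEntry A)) :
    flagWord N (u.map φ) (l.map (GatheringEntry.map φ)) =
      (flagWord N u l).map (mapFlagged φ) := by
  simp only [flagWord, flagTail, GatheringEntry.map, cyclePow_map, List.flatMap_map,
    List.map_append, List.map_flatMap, ← flag_map]

theorem lowerFrom_map (pre as : List A) :
    lowerFrom (pre.map φ) (as.map φ) = (lowerFrom pre as).map (mapRaw φ) := by
  induction as generalizing pre with
  | nil => rfl
  | cons a as ih =>
    have := ih (pre ++ [a])
    simp only [List.map_append, List.map_cons, List.map_nil] at this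
    simp [lowerFrom, mapRaw, this]

theorem upperPart_map (bs : List A) : upperPart (bs.map φ) = (upperPart bs).map (mapRaw φ) := by
  induction bs with
  | nil => rfl
  | cons b bs ih => simp [upperPart, mapRaw, ih]

theorem unfold_map (g : GatheringEntry A) (m : RawTail A) :
    (g.map φ).unfold (m.map (mapRaw φ)) = (g.unfold m).map (mapRaw φ) := by
  have := lowerFrom_map φ [] g.1.1
  rw [List.map_nil] at this
  simp [GatheringEntry.unfold, GatheringEntry.map, lowerPart_eq, this, upperPart_map, mapRaw]

theorem richTail_map (N : ℕ) (l : List (GatheringEntry A)) :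
    richTail N (l.map (GatheringEntry.map φ)) = (richTail N l).map (mapRaw φ) := by
  have h : ∀ as z : List A, richMiddle (as.map φ) (z.map φ) =
      (richMiddle as z).map (mapRaw φ) := by
    intro as z
    simp [richMiddle, mapRaw]
  simp only [richTail, List.flatMap_map, List.map_flatMap, ← unfold_map, ← h, ← cyclePow_map]
  rfl

variable [DecidableEq A] [DecidableEq B]

theorem poorMiddles_map (hφ : Function.Injective φ) (as z : List A) :
    poorMiddles (as.map φ) (z.map φ) = (poorMiddles as z).map (List.map (mapRaw φ)) := by
  induction z with
  | nil => rfl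
  | cons c z ih =>
    have : (as.map φ).filter (fun a => a ≠ φ c) = (as.filter fun a => a ≠ c).map φ := by
      rw [List.filter_map]
      congr 1
      refine List.filter_congr fun a _ => ?_
      simp [hφ.eq_iff]
    simp only [poorMiddles, List.map_cons, ih, this, List.map_map]
    rfl

theorem poorTails_map (hφ : Function.Injective φ) (N : ℕ) (l : List (GatheringEntry A)) :
    poorTails N (l.map (GatheringEntry.map φ)) = (poorTails N l).map (List.map (mapRaw φ)) := by
  induction l with
  | nil => rfl
  | cons g l ih =>
    have h1 : poorMiddles (g.map φ).1.1 (cyclePow N (g.map φ).1.1) =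
        (poorMiddles g.1.1 (cyclePow N g.1.1)).map (List.map (mapRaw φ)) := by
      rw [← poorMiddles_map φ hφ, ← cyclePow_map]
      rfl
    simp only [poorTails, List.map_cons, ih, h1, List.map_map, List.map_append]
    congr 1
    refine List.map_congr_left fun m _ => ?_
    simp only [Function.comp, unfold_map, List.map_append, List.map_map]
    rfl

end Codes

/-! ### Path-schemes given as bare data and their codes -/

section Schemes

variable {d : ℕ} {S : Finset (Fin d → ℤ)}

/-- The code of a letter of the system. -/
def codeOf (t : S) : LetterCode := letterCode (t : Fin d → ℤ)

theorem wordCode_eq (w : List S) : wordCode w = w.map codeOf := by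
  simp [wordCode, codeOf]

theorem codeOf_injective : Function.Injective (codeOf (S := S)) :=
  fun _ _ h => Subtype.ext (List.ofFn_injective h)

/-- Bubbles given as bare data that come from a bubble. -/
def RawBubble.Valid {A : Type} : RawBubble A → Prop
  | .inl B => B.Nodup
  | .inr g => g.1.Nodup ∧ g.1.Perm g.2

theorem RawBubble.Valid.exists_bubble {b : RawBubble S} (h : RawBubble.Valid b) :
    ∃ X : Bubble S, X.IsCode (Sum.map (List.map codeOf)
      (Prod.map (List.map codeOf) (List.map codeOf)) b) ∧
      X.language = RawBubble.language b ∧ X.size = RawBubble.size b := by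
  classical
  rcases b with B | ⟨as, bs⟩
  · refine ⟨.star B.toFinset, ⟨B, h, by simp, congrArg Sum.inl (wordCode_eq B).symm⟩, ?_,
      List.toFinset_card_of_nodup h⟩
    ext w
    show (∀ a ∈ w, a ∈ B.toFinset) ↔ ∀ a ∈ w, a ∈ B
    simp
  · refine ⟨.gathering as bs h.1 h.2, ?_, rfl, rfl⟩
    simp [Bubble.IsCode, wordCode_eq]

theorem exists_tail {t : RawTail S} (ht : ∀ p ∈ t, RawBubble.Valid p.1) :
    ∃ l : List (Bubble S × List S),
      List.Forall₂ (fun p q => p.1.IsCode q.1 ∧ q.2 = wordCode p.2) l (t.map (mapRaw codeOf)) ∧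
      (l.map fun p => p.1.language * ({p.2} : Language S)).prod = tailLanguage t ∧
      ∀ i, (l.map fun p => p.1.weight).sum i = sizeCount (i.val + 1) t := by
  induction t with
  | nil => exact ⟨[], List.Forall₂.nil, rfl, fun _ => rfl⟩
  | cons p t ih =>
    obtain ⟨l, h1, h2, h3⟩ := ih fun p hp => ht p (by simp [hp])
    obtain ⟨X, hX, hL, hs⟩ := (ht p (by simp)).exists_bubble
    refine ⟨(X, p.2) :: l, List.Forall₂.cons ⟨hX, (wordCode_eq _).symm⟩ h1, ?_, fun i => ?_⟩
    · rw [List.map_cons, List.prod_cons, h2, hL, tailLanguage_cons]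
    · rw [List.map_cons, List.sum_cons, Pi.add_apply, h3, sizeCount, sizeCount, List.countP_cons,
        add_comm]
      simp [Bubble.weight, hs]

theorem exists_entries {l : List (Bubble S × List S)} {q : RawTail LetterCode}
    (hl : ∀ p ∈ l, p.1.IsGathering)
    (hq : List.Forall₂ (fun p q => p.1.IsCode q.1 ∧ q.2 = wordCode p.2) l q) :
    ∃ e : List (GatheringEntry S), (∀ g ∈ e, g.1.1.Nodup ∧ g.1.1.Perm g.1.2) ∧
      readTail q = e.map (GatheringEntry.map codeOf) ∧
      (l.map fun p => p.1.language * ({p.2} : Language S)).prod =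
        tailLanguage (e.map GatheringEntry.toRaw) ∧
      ∀ i, (l.map fun p => p.1.weight).sum i =
        sizeCount (i.val + 1) (e.map GatheringEntry.toRaw) := by
  induction hq with
  | nil => exact ⟨[], by simp, rfl, rfl, fun _ => rfl⟩
  | @cons p q l t h _ ih =>
    obtain ⟨e, h0, h1, h2, h3⟩ := ih fun p hp => hl p (by simp [hp])
    obtain ⟨X, u⟩ := p
    obtain ⟨c, v⟩ := q
    obtain ⟨hX, hv⟩ := h
    cases X with
    | star B => exact (hl (.star B, u) (by simp)).elim
    | gathering as bs hn hp =>
      simp only [Bubble.IsCode] at hX hv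
      subst hX hv
      refine ⟨((as, bs), u) :: e, ?_, ?_, ?_, fun i => ?_⟩
      · intro g hg
        rcases List.mem_cons.1 hg with rfl | hg
        · exact ⟨hn, hp⟩
        · exact h0 g hg
      · simp only [readTail, List.map_cons] at h1 ⊢
        rw [h1, wordCode_eq, wordCode_eq, wordCode_eq]
        rfl
      · rw [List.map_cons, List.prod_cons, h2, List.map_cons, tailLanguage_cons]
        rfl
      · rw [List.map_cons, List.sum_cons, Pi.add_apply, h3, sizeCount, sizeCount, List.map_cons,
          List.countP_cons, add_comm]
        by_cases hi : as.length = i.val + 1 <;>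
          simp [Bubble.weight, Bubble.size, RawBubble.size, GatheringEntry.toRaw, hi]

variable {A : Type}

theorem valid_unfold {g : GatheringEntry A} (hn : g.1.1.Nodup) (hp : g.1.1.Perm g.1.2)
    {m : RawTail A} (hm : ∀ p ∈ m, RawBubble.Valid p.1) :
    ∀ p ∈ g.unfold m, RawBubble.Valid p.1 := by
  have h1 : ∀ as pre : List A, (pre ++ as).Nodup → ∀ p ∈ lowerFrom pre as,
      RawBubble.Valid p.1 := by
    intro as
    induction as with
    | nil => simp [lowerFrom]
    | cons a as ih =>
      intro pre h p hp
      simp only [lowerFrom, List.mem_cons] at hp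
      rcases hp with rfl | hp
      · exact h.of_append_left
      · exact ih (pre ++ [a]) (by simpa using h) p hp
  have h2 : ∀ bs : List A, bs.Nodup → ∀ p ∈ upperPart bs, RawBubble.Valid p.1 := by
    intro bs
    induction bs with
    | nil => simp [upperPart]
    | cons b bs ih =>
      intro h p hp
      simp only [upperPart, List.mem_cons] at hp
      rcases hp with rfl | rfl | hp
      · exact List.nodup_nil
      · exact (List.nodup_cons.1 h).2
      · exact ih (List.nodup_cons.1 h).2 p hp
  intro p h
  simp only [GatheringEntry.unfold, lowerPart_eq, List.mem_append, List.mem_singleton] at h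
  rcases h with ((h | h) | h) | rfl
  · exact h1 g.1.1 [] hn p h
  · exact hm p h
  · exact h2 _ (hp.nodup_iff.1 hn) p h
  · exact List.nodup_nil

theorem valid_richTail {N : ℕ} {l : List (GatheringEntry A)}
    (hl : ∀ g ∈ l, g.1.1.Nodup ∧ g.1.1.Perm g.1.2) :
    ∀ p ∈ richTail N l, RawBubble.Valid p.1 := by
  intro p hp
  obtain ⟨g, hg, hp⟩ := List.mem_flatMap.1 hp
  refine valid_unfold (hl g hg).1 (hl g hg).2 (fun p hp => ?_) p hp
  simp only [richMiddle, List.mem_append, List.mem_map, List.mem_singleton] at hp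
  rcases hp with ⟨c, -, rfl⟩ | rfl <;> exact (hl g hg).1

theorem valid_poorTails [DecidableEq A] {N : ℕ} {l : List (GatheringEntry A)}
    (hl : ∀ g ∈ l, g.1.1.Nodup ∧ g.1.1.Perm g.1.2) {t : RawTail A} (ht : t ∈ poorTails N l) :
    ∀ p ∈ t, RawBubble.Valid p.1 := by
  have hm : ∀ (as z : List A), as.Nodup → ∀ m ∈ poorMiddles as z, ∀ p ∈ m,
      RawBubble.Valid p.1 := by
    intro as z hn
    induction z with
    | nil => simp [poorMiddles]
    | cons c z ih =>
      intro m hm p hp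
      simp only [poorMiddles, List.mem_cons, List.mem_map] at hm
      rcases hm with rfl | ⟨m, hm, rfl⟩
      · obtain rfl := List.mem_singleton.1 hp
        exact hn.filter _
      · rcases List.mem_cons.1 hp with rfl | hp
        · exact hn.filter _
        · exact ih m hm p hp
  induction l generalizing t with
  | nil => simp [poorTails] at ht
  | cons g l ih =>
    intro p hp
    simp only [poorTails, List.mem_append, List.mem_map] at ht
    rcases ht with ⟨m, hm', rfl⟩ | ⟨t, ht, rfl⟩
    · rcases List.mem_append.1 hp with hp | hp
      · exact valid_unfold (hl g (by simp)).1 (hl g (by simp)).2 (hm _ _ (hl g (by simp)).1 m hm')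
          p hp
      · obtain ⟨g', hg', rfl⟩ := List.mem_map.1 hp
        exact hl g' (by simp [hg'])
    · rcases List.mem_cons.1 hp with rfl | hp
      · exact hl g (by simp)
      · exact ih (fun g hg => hl g (by simp [hg])) ht p hp

/-- A valid certificate with `N` rounds exists iff the word `flagWord N u e` labels a run that
respects its flags. -/
theorem check_iff {x y : Config d} {c : InputCode} {u : List S} {e : List (GatheringEntry S)}
    (h1 : c.1 = d) (h2 : c.2.2.1 = configCode x) (h3 : c.2.2.2.1 = configCode y)
    (h4 : c.2.2.2.2.1 = wordCode u)
    (h5 : readTail c.2.2.2.2.2 = e.map (GatheringEntry.map codeOf)) (N : ℕ) :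
    FlaggedRun x (flagWord N u e) y ↔ ∃ D zs ps, Check c (N, D, zs, ps) := by
  have hw : inputWord c N = (flagWord N u e).map (mapFlagged codeOf) := by
    rw [inputWord, h4, h5, wordCode_eq, flagWord_map]
  rw [flaggedRun_iff_exists_certificate]
  simp only [Check, hw, h1, h2, h3, List.length_map]
  have hk : ∀ k, ∀ h : k < (flagWord N u e).length,
      ((flagWord N u e).map (mapFlagged codeOf)).getD k default =
        ((flagWord N u e)[k].1, letterCode ((flagWord N u e)[k].2 : Fin d → ℤ)) := by
    intro k h
    simp [List.getD_eq_getElem?_getD, h, mapFlagged, codeOf]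
  refine exists_congr fun D => exists_congr fun zs => exists_congr fun ps => ?_
  refine and_congr_right fun _ => and_congr_right fun _ => and_congr_right fun _ => ?_
  exact forall_congr' fun k => forall_congr' fun h => by rw [hk k h]

theorem exists_schemes (u : List S) {T : List (RawTail S)}
    (hT : ∀ t ∈ T, ∀ p ∈ t, RawBubble.Valid p.1) :
    ∃ ρs : List (PathScheme S),
      List.Forall₂ (fun τ c => τ.IsCode c) ρs
        (T.map fun t => (wordCode u, t.map (mapRaw codeOf))) ∧
      (∀ w, (∃ τ ∈ ρs, w ∈ τ.language) ↔
        ∃ t ∈ T, w ∈ ({u} : Language S) * tailLanguage t) ∧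
      ∀ τ ∈ ρs, ∃ t ∈ T, ∀ i, τ.weight i = sizeCount (i.val + 1) t := by
  induction T with
  | nil => exact ⟨[], List.Forall₂.nil, by simp, by simp⟩
  | cons t T ih =>
    obtain ⟨ρs, i1, i2, i3⟩ := ih fun t ht => hT t (by simp [ht])
    obtain ⟨r, r1, r2, r3⟩ := exists_tail (hT t (by simp))
    have r4 : PathScheme.language ⟨u, r⟩ = {u} * tailLanguage t := congrArg _ r2
    refine ⟨⟨u, r⟩ :: ρs, List.Forall₂.cons ⟨rfl, r1⟩ i1, fun w => ?_, fun τ hτ => ?_⟩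
    · simp only [List.mem_cons, exists_eq_or_imp, i2, r4]
    · rcases List.mem_cons.1 hτ with rfl | hτ
      · exact ⟨t, by simp, r3⟩
      · obtain ⟨t', ht', h⟩ := i3 τ hτ
        exact ⟨t', by simp [ht'], h⟩

/-- On the code of a perfect path-scheme the search halts, and its output is the code of a correct
decomposition. -/
theorem decompose_spec {x y : Config d} {ρ : PathScheme S} (hρ : ρ.IsPerfect x y) {c : InputCode}
    (hc : IsInputCode S x y ρ c) :
    ∃ out ∈ decompose c, ∃ (σ : PathScheme S) (ρs : List (PathScheme S)),
      σ.IsCode out.1 ∧ List.Forall₂ (fun τ e => τ.IsCode e) ρs out.2 ∧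
      (∀ w, w ∈ ρ.language ↔ w ∈ σ.language ∨ ∃ τ ∈ ρs, w ∈ τ.language) ∧
      (∀ w, w ∈ σ.language → w ∈ transitionLanguage S x y) ∧
      ∀ τ ∈ ρs, LexLT τ.weight ρ.weight := by
  classical
  obtain ⟨u, l⟩ := ρ
  obtain ⟨hgath, w, hw, hwt⟩ := hρ
  obtain ⟨h1, -, h2, h3, h4, h5⟩ := hc
  obtain ⟨e, he, hread, hlang, hweight⟩ := exists_entries hgath h5
  have hlangρ : PathScheme.language ⟨u, l⟩ = {u} * tailLanguage (e.map GatheringEntry.toRaw) :=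
    congrArg _ hlang
  -- The search succeeds, since a long power of the letters of each gathering can be fired.
  have hdom : (decompose c).Dom := by
    rw [hlangρ] at hw
    obtain ⟨_, rfl, w, hw, rfl⟩ := hw
    obtain ⟨p, hu, hwt⟩ := transitionLanguage_split hwt
    obtain ⟨N, hN⟩ := exists_flagTail_run he hw hwt
    obtain ⟨D, zs, ps, hq⟩ := (check_iff h1 h2 h3 h4 hread N).1
      (flaggedRun_append.2 ⟨p, flaggedRun_plain.2 hu, hN N le_rfl⟩)
    refine Nat.rfindOpt_dom.2 ⟨Encodable.encode ((N, D, zs, ps) : Certificate), output c N, ?_⟩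
    simp [attempt, hq]
  obtain ⟨out, hout⟩ := Part.dom_iff_mem.1 hdom
  refine ⟨out, hout, ?_⟩
  obtain ⟨n, hn⟩ := Nat.rfindOpt_spec hout
  obtain ⟨⟨N, D, zs, ps⟩, -, hn⟩ := Option.bind_eq_some_iff.1 hn
  split_ifs at hn with hq
  obtain rfl := Option.some_injective _ hn
  obtain ⟨p, hu, hrun⟩ := flaggedRun_append.1
    ((check_iff h1 h2 h3 h4 hread N).2 ⟨D, zs, ps, hq⟩)
  rw [flaggedRun_plain] at hu
  obtain ⟨s, hs1, hs2, -⟩ := exists_tail (valid_richTail (N := N) he)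
  obtain ⟨ρs, i1, i2, i3⟩ := exists_schemes u (T := poorTails N e) fun t ht => valid_poorTails he ht
  have hlangσ : PathScheme.language ⟨u, s⟩ = {u} * tailLanguage (richTail N e) := congrArg _ hs2
  refine ⟨⟨u, s⟩, ρs, ⟨h4, ?_⟩, ?_, fun w => ?_, fun w hw => ?_, fun τ hτ => ?_⟩
  · simp only [output, hread, richTail_map]
    exact hs1
  · simp only [output, hread, poorTails_map codeOf codeOf_injective, List.map_map, h4]
    exact i1
  · rw [hlangρ, hlangσ, i2]
    constructor
    · rintro ⟨_, rfl, w, hw, rfl⟩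
      rcases (tail_decomposition he N w).1 hw with h | ⟨t, ht, h⟩
      · exact Or.inl ⟨_, rfl, w, h, rfl⟩
      · exact Or.inr ⟨t, ht, _, rfl, w, h, rfl⟩
    · rintro (⟨_, rfl, w, hw, rfl⟩ | ⟨t, ht, _, rfl, w, hw, rfl⟩)
      · exact ⟨_, rfl, w, (tail_decomposition he N w).2 (Or.inl hw), rfl⟩
      · exact ⟨_, rfl, w, (tail_decomposition he N w).2 (Or.inr ⟨t, ht, hw⟩), rfl⟩
  · rw [hlangσ] at hw
    obtain ⟨_, rfl, w, hw, rfl⟩ := hw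
    exact transitionLanguage_append hu (richTail_subset (fun g hg => (he g hg).2) hrun hw)
  · obtain ⟨t, ht, hτt⟩ := i3 τ hτ
    obtain ⟨g, hg, hpos, hlt, heq⟩ := sizeCount_poorTails (fun g hg => (he g hg).2) ht
    have hcard := (he g hg).1.length_le_card
    have hρw : ∀ i, PathScheme.weight ⟨u, l⟩ i =
      sizeCount (i.val + 1) (e.map GatheringEntry.toRaw) := hweight
    refine ⟨⟨g.1.1.length - 1, by omega⟩, ?_, fun j hj => ?_⟩
    · rw [hτt, hρw]
      simpa only [Nat.sub_add_cancel hpos] using hlt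
    · rw [hτt, hρw]
      have := Fin.lt_def.1 hj
      simp only at this
      exact heq _ (by omega)

end Schemes

end CVAS

theorem mainTheorem4 :
    ∃ f : CVAS.InputCode →. CVAS.SchemeCode × List CVAS.SchemeCode, Partrec f ∧
      ∀ (d : ℕ) (S : Finset (Fin d → ℤ)) (x y : CVAS.Config d) (ρ : CVAS.PathScheme S),
        ρ.IsPerfect x y →
        ∀ c : CVAS.InputCode, CVAS.IsInputCode S x y ρ c →
          ∃ out ∈ f c, ∃ (σ : CVAS.PathScheme S) (ρs : List (CVAS.PathScheme S)),
            σ.IsCode out.1 ∧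
            List.Forall₂ (fun τ e => τ.IsCode e) ρs out.2 ∧
            (∀ w, w ∈ ρ.language ↔ w ∈ σ.language ∨ ∃ τ ∈ ρs, w ∈ τ.language) ∧
            (∀ w, w ∈ σ.language → w ∈ CVAS.transitionLanguage S x y) ∧
            ∀ τ ∈ ρs, CVAS.LexLT τ.weight ρ.weight :=
  ⟨CVAS.decompose, CVAS.partrec_decompose, fun _ _ _ _ _ hρ _ hc => CVAS.decompose_spec hρ hc⟩
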